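/- For $p>0$ let $\|f\|_p=\big(\int_0^1|f(x)|^p\,dx\big)^{1/p}$ on the torus $\mathbb T=\mathbb R/\mathbb Z$, and for integers $N\ge1$, $A\ge2$, $k\ge0$ and real $s$ put $$K_N(x)=\sum_{n=1}^{N}e^{2\pi i n^2x},\qquad \Delta_{k}(x)=\Delta_{k}^{A,s}(x)=\sum_{n=A^k}^{A^{k+1}-1}\frac{e^{2\pi i n^2x}}{n^{2s}},$$ $$\rho_p(k)=\rho_p^{A,s}(k)=\begin{cases}A^{k(1/2-2s)},&p<4,\\ A^{k(1/2-2s)}\,k^{1/4},&p=4,\\ A^{k(1-2/p-2s)},&p>4.\end{cases}$$ Proposition. Let $p>0$. (i) There is an integer $A_p\ge2$, depending only on $p$, such that for every integer $A\ge A_p$ and every $s\in\mathbb R$ there are constants $c,C>0$ (depending only on $p,s,A$) with $$c\,\frac{\|K_{A^k}\|_p}{A^{2ks}}\le\|\Delta_k\|_p\le C\,\frac{\|K_{A^k}\|_p}{A^{2ks}}\qquad\text{for all integers }k\ge0.$$ (ii) If $p\ne4$, there are constants $c,C>0$ depending only on $p$ such that, for all integers $A\ge2$, all $s\in\mathbb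 R$ and all integers $k\ge0$, $$c\,\rho_p(k)\le\frac{\|K_{A^k}\|_p}{A^{2ks}}\le C\,\rho_p(k).$$ If $p=4$, the same holds for all $s\in\mathbb R$ and all integers $k\ge1$, for each integer $A\ge2$, with constants $c,C>0$ depending only on $A$. In particular, for $A\ge A_p$ we have $\|\Delta_k\|_p\asymp\|K_{A^k}\|_p/A^{2ks}\asymp\rho_p(k)$, uniformly in $k\ge0$ if $p\neq4$, and in $k\ge1$ if $p=4$. -/

import Mathlib

open MeasureTheory

noncomputable section

/-- The `L^p` norm (quasi-norm if `p < 1`) on the torus `ℝ / ℤ` with its Haar measure of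
total mass one: `(∫ |f|^p)^(1/p)`, for a real exponent `0 < p < ∞`. -/
def torusNorm (p : ℝ) (f : UnitAddCircle → ℂ) : ℝ :=
  (eLpNorm f (ENNReal.ofReal p) volume).toReal

/-- `K_N(x) = ∑_{n=1}^N e^{2πi n² x}`; here `fourier m x = e^{2πi m x}`. -/
def squareSum (N : ℕ) (x : UnitAddCircle) : ℂ :=
  ∑ n ∈ Finset.Icc 1 N, fourier ((n : ℤ) ^ 2) x

/-- The Littlewood-Paley block `∑_{A^k ≤ n < A^{k+1}} e^{2πi n² x} / n^{2s}`. -/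
def squareBlock (s : ℝ) (A k : ℕ) (x : UnitAddCircle) : ℂ :=
  ∑ n ∈ Finset.Ico (A ^ k) (A ^ (k + 1)),
    fourier ((n : ℤ) ^ 2) x / (((n : ℝ) ^ (2 * s) : ℝ) : ℂ)

/-- The order of magnitude of the `L^p` norm of the `k`-th block. -/
def blockRate (p s : ℝ) (A k : ℕ) : ℝ :=
  if p < 4 then (A : ℝ) ^ ((k : ℝ) * (1 / 2 - 2 * s))
  else if p = 4 then (A : ℝ) ^ ((k : ℝ) * (1 / 2 - 2 * s)) * (k : ℝ) ^ (1 / 4 : ℝ)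
  else (A : ℝ) ^ ((k : ℝ) * (1 - 2 / p - 2 * s))

end

/-! ### The `L^p` norm of continuous functions on the torus -/

/-! Both `K_N` and the blocks are sums `weightedSum w P N` with monotone weights. They are compared
with one rate, `gaussRate p N`: N^(1/2) for p < 4, N^(1/2) (1 + log N)^(1/4) for p = 4, N^(1 - 2/p)
for p > 4. On a block the weights n^(-2s) equal A^(-2ks) up to a factor depending on A and s, so the
comparison of blocks with `K_{A^k}` follows.

Upper bound. The sum is averaged over N/8 shifts of its window. Weyl differencing of the average
produces a Fejér kernel, hence squares min(N, 1/‖2hx‖)² and no logarithmic loss. Dirichlet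
approximation controls the spacing of the points 2hx and gives |average|² ≲ N + N²/(q + N²‖2qx‖) for
some q ≤ 4N depending on x (`exists_norm_sq_averagedSum_le`). The map x ↦ 2qx preserves measure, so
the p/2-th power of the last term has integral ≲ (N²/q)^(p/2 - 1). Summing over q yields `gaussRate
p N ^ p`; the exponent p = 4 is where the sum over q becomes harmonic. The end pieces removed by
averaging are at most N/8 long and are absorbed by induction (`exists_torusNorm_shiftedSum_le`);
summation by parts brings in the weights. This needs p > 2 and is done for p ≥ 3; smaller p follow
from p = 3.

Lower bound. For p < 4, Parseval and the L³ upper bound force a large L^p norm by interpolation. For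
p > 4, all terms have nearly the same phase when ‖x‖ ≲ N^(-2). For p = 4, the norm counts solutions
of n₁² + n₂² = n₃² + n₄², and an explicit parametrization provides ≳ N² log N of them
(`exists_mul_le_card_equalSquareSums`). -/

instance UnitAddCircle.isProbabilityMeasure_volume :
    IsProbabilityMeasure (volume : Measure UnitAddCircle) :=
  ⟨UnitAddCircle.measure_univ⟩

theorem Continuous.memLp_unitAddCircle {f : UnitAddCircle → ℂ} (hf : Continuous f) (q : ENNReal) :
    MemLp f q volume := by
  obtain ⟨C, hC⟩ := isCompact_univ.exists_bound_of_continuousOn hf.continuousOn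
  exact MemLp.of_bound hf.aestronglyMeasurable C (Filter.Eventually.of_forall fun x => hC x trivial)

theorem Continuous.integrable_unitAddCircle {f : UnitAddCircle → ℝ} (hf : Continuous f) :
    Integrable f volume := by
  obtain ⟨C, hC⟩ := isCompact_univ.exists_bound_of_continuousOn hf.continuousOn
  exact Integrable.of_bound hf.aestronglyMeasurable C
    (Filter.Eventually.of_forall fun x => hC x trivial)

theorem Continuous.integrable_unitAddCircle_complex {f : UnitAddCircle → ℂ} (hf : Continuous f) :
    Integrable f volume :=
  memLp_one_iff_integrable.1 (hf.memLp_unitAddCircle 1)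

theorem torusNorm_nonneg (p : ℝ) (f : UnitAddCircle → ℂ) : 0 ≤ torusNorm p f :=
  ENNReal.toReal_nonneg

theorem torusNorm_rpow {p : ℝ} (hp : 0 < p) {f : UnitAddCircle → ℂ} (hf : Continuous f) :
    torusNorm p f ^ p = ∫ x, ‖f x‖ ^ p := by
  have h0 : ENNReal.ofReal p ≠ 0 := by simpa using hp
  have hI : 0 ≤ ∫ x, ‖f x‖ ^ p := integral_nonneg fun x => by positivity
  rw [torusNorm, (hf.memLp_unitAddCircle _).eLpNorm_eq_integral_rpow_norm h0 ENNReal.ofReal_ne_top,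
    ENNReal.toReal_ofReal (by positivity), ENNReal.toReal_ofReal hp.le,
    Real.rpow_inv_rpow hI hp.ne']

theorem torusNorm_le_of_integral_le {p B : ℝ} (hp : 0 < p) (hB : 0 ≤ B) {f : UnitAddCircle → ℂ}
    (hf : Continuous f) (h : ∫ x, ‖f x‖ ^ p ≤ B ^ p) : torusNorm p f ≤ B := by
  rw [← torusNorm_rpow hp hf] at h
  exact (Real.rpow_le_rpow_iff (torusNorm_nonneg _ _) hB hp).1 h

theorem le_torusNorm_of_le_integral {p B : ℝ} (hp : 0 < p) (hB : 0 ≤ B) {f : UnitAddCircle → ℂ}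
    (hf : Continuous f) (h : B ^ p ≤ ∫ x, ‖f x‖ ^ p) : B ≤ torusNorm p f := by
  rw [← torusNorm_rpow hp hf] at h
  exact (Real.rpow_le_rpow_iff hB (torusNorm_nonneg _ _) hp).1 h

theorem torusNorm_mono_exponent {p q : ℝ} (hpq : p ≤ q) {f : UnitAddCircle → ℂ}
    (hf : Continuous f) : torusNorm p f ≤ torusNorm q f :=
  ENNReal.toReal_mono (hf.memLp_unitAddCircle _).eLpNorm_ne_top
    (eLpNorm_le_eLpNorm_of_exponent_le (ENNReal.ofReal_le_ofReal hpq) hf.aestronglyMeasurable)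

theorem torusNorm_add_le {p : ℝ} (hp : 1 ≤ p) {f g : UnitAddCircle → ℂ} (hf : Continuous f)
    (hg : Continuous g) : torusNorm p (fun x => f x + g x) ≤ torusNorm p f + torusNorm p g := by
  have h := eLpNorm_add_le (μ := volume) (p := ENNReal.ofReal p) hf.aestronglyMeasurable
    hg.aestronglyMeasurable (by simpa using hp)
  rw [torusNorm, torusNorm, torusNorm, ← ENNReal.toReal_add
    (hf.memLp_unitAddCircle _).eLpNorm_ne_top (hg.memLp_unitAddCircle _).eLpNorm_ne_top]
  exact ENNReal.toReal_mono (ENNReal.add_ne_top.2 ⟨(hf.memLp_unitAddCircle _).eLpNorm_ne_top,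
    (hg.memLp_unitAddCircle _).eLpNorm_ne_top⟩) h

theorem torusNorm_const_mul (p : ℝ) (c : ℂ) (f : UnitAddCircle → ℂ) :
    torusNorm p (fun x => c * f x) = ‖c‖ * torusNorm p f := by
  have h := eLpNorm_const_smul (μ := volume) c f (ENNReal.ofReal p)
  have h' : torusNorm p (fun x => c * f x) = torusNorm p (c • f) := rfl
  rw [h', torusNorm, torusNorm, h, ENNReal.toReal_mul, toReal_enorm]

theorem torusNorm_zero (p : ℝ) : torusNorm p (fun _ => 0) = 0 := by
  have := torusNorm_const_mul p 0 (fun _ => 0)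
  simpa using this

theorem torusNorm_sum_le {p : ℝ} (hp : 1 ≤ p) {ι : Type*} (s : Finset ι)
    {f : ι → UnitAddCircle → ℂ} (hf : ∀ i ∈ s, Continuous (f i)) :
    torusNorm p (fun x => ∑ i ∈ s, f i x) ≤ ∑ i ∈ s, torusNorm p (f i) := by
  classical
  induction s using Finset.induction_on with
  | empty => simp [torusNorm_zero]
  | insert a s ha ih =>
    simp only [Finset.sum_insert ha]
    have h1 := hf a (Finset.mem_insert_self a s)
    have h2 : ∀ i ∈ s, Continuous (f i) := fun i hi => hf i (Finset.mem_insert_of_mem hi)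
    exact (torusNorm_add_le hp h1 (continuous_finsetSum s h2)).trans (by gcongr; exact ih h2)

theorem norm_fourier_apply (n : ℤ) (x : UnitAddCircle) : ‖fourier n x‖ = 1 := Circle.norm_coe _

theorem continuous_fourier (n : ℤ) : Continuous fun x : UnitAddCircle => fourier n x :=
  (fourier n).continuous

theorem torusNorm_fourier {p : ℝ} (hp : 0 < p) (n : ℤ) :
    torusNorm p (fun x => fourier n x) = 1 := by
  have h := torusNorm_rpow hp (continuous_fourier n)
  simp only [norm_fourier_apply, Real.one_rpow, integral_const, smul_eq_mul, mul_one] at h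
  have h' : torusNorm p (fun x => fourier n x) ^ p = 1 ^ p := by
    rw [h]; simp
  exact (Real.rpow_left_inj (torusNorm_nonneg _ _) zero_le_one hp.ne').1 h'

theorem integral_fourier (n : ℤ) :
    ∫ x : UnitAddCircle, fourier n x = if n = 0 then 1 else 0 := by
  have h := fourierCoeff_fourier (T := (1 : ℝ)) n
  have h0 := congrFun h 0
  rw [fourierCoeff] at h0
  have hv : (volume : Measure UnitAddCircle) = AddCircle.haarAddCircle := by
    have := AddCircle.volume_eq_smul_haarAddCircle (T := (1 : ℝ))
    simpa using this
  rw [hv]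
  simp only [neg_zero, fourier_zero, one_smul] at h0
  rw [h0, Pi.single_apply]
  simp [eq_comm]

/-! ### Weyl differencing for averaged quadratic exponential sums -/

theorem UnitAddCircle.exists_coe_eq_abs_eq_norm (y : UnitAddCircle) :
    ∃ t : ℝ, (t : UnitAddCircle) = y ∧ |t| = ‖y‖ ∧ |t| ≤ 1 / 2 := by
  induction y using QuotientAddGroup.induction_on with | _ s
  refine ⟨s - round s, ?_, UnitAddCircle.norm_eq.symm, abs_sub_round s⟩
  have h : ((round s : ℝ) : UnitAddCircle) = 0 := by
    rw [AddCircle.coe_eq_zero_iff]; exact ⟨round s, by simp⟩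
  rw [AddCircle.coe_sub, h, sub_zero]

theorem fourier_eq_exp_two_pi_mul {n : ℤ} {x : UnitAddCircle} {t : ℝ}
    (ht : (t : UnitAddCircle) = n • x) :
    fourier n x = Complex.exp (Complex.I * ((2 * Real.pi * t : ℝ) : ℂ)) := by
  have h := fourier_coe_apply (T := (1 : ℝ)) (n := 1) (x := t)
  rw [fourier_apply, one_zsmul, ht] at h
  rw [fourier_apply, h]
  congr 1; push_cast; ring

/-- |e^{iθ} - 1| = 2 |sin(θ/2)|, and Jordan's inequality |sin u| ≥ 2|u|/π holds on |u| ≤ π/2. -/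
theorem four_mul_norm_le_norm_fourier_sub_one (n : ℤ) (x : UnitAddCircle) :
    4 * ‖n • x‖ ≤ ‖fourier n x - 1‖ := by
  obtain ⟨t, ht, hnorm, hle⟩ := UnitAddCircle.exists_coe_eq_abs_eq_norm (n • x)
  rw [fourier_eq_exp_two_pi_mul ht, Complex.norm_exp_I_mul_ofReal_sub_one, ← hnorm, norm_mul,
    Real.norm_eq_abs, Real.norm_eq_abs, abs_two, show 2 * Real.pi * t / 2 = Real.pi * t by ring]
  have hpi := Real.pi_pos
  have habs : |Real.pi * t| = Real.pi * |t| := by rw [abs_mul, abs_of_pos hpi]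
  have h := Real.mul_abs_le_abs_sin (x := Real.pi * t) (by rw [habs]; nlinarith)
  rw [habs, show 2 / Real.pi * (Real.pi * |t|) = 2 * |t| by field_simp] at h
  linarith

theorem norm_sum_fourier_mul_le (K : ℕ) (n : ℤ) (x : UnitAddCircle) :
    ‖∑ a ∈ Finset.range K, fourier ((a : ℤ) * n) x‖ ≤ K := by
  refine (norm_sum_le _ _).trans ?_
  simp [norm_fourier_apply, -fourier_apply]

theorem norm_sum_fourier_mul_mul_norm_le (K : ℕ) (n : ℤ) (x : UnitAddCircle) :
    ‖∑ a ∈ Finset.range K, fourier ((a : ℤ) * n) x‖ * ‖n • x‖ ≤ 1 / 2 := by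
  have hpow : ∀ a : ℕ, fourier ((a : ℤ) * n) x = fourier n x ^ a := by
    intro a
    induction a with
    | zero => simp
    | succ a ih => rw [pow_succ, ← ih, ← fourier_add]; congr 2; push_cast; ring
  have hgeom := geom_sum_mul (fourier n x) K
  simp only [hpow]
  have h2 : ‖fourier n x ^ K - 1‖ ≤ 2 := by
    refine (norm_sub_le _ _).trans ?_
    rw [norm_pow, norm_fourier_apply]; norm_num
  rw [← hgeom, norm_mul] at h2
  have h4 := four_mul_norm_le_norm_fourier_sub_one n x
  have h5 := mul_le_mul_of_nonneg_left h4 (norm_nonneg (∑ a ∈ Finset.range K, fourier n x ^ a))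
  linarith

/-- Each distance h is attained by at most two values of m', namely m - h and m + h. -/
theorem sum_range_natAbs_sub_le {G : ℕ → ℝ} (hG : ∀ n, 0 ≤ G n) {m M : ℕ} (hm : m < M) :
    ∑ m' ∈ Finset.range M, G ((m : ℤ) - m').natAbs ≤ 2 * ∑ h ∈ Finset.range M, G h := by
  rw [← Finset.sum_range_add_sum_Ico _ (Nat.succ_le_of_lt hm), two_mul]
  refine add_le_add ?_ ?_
  · have h1 : ∑ m' ∈ Finset.range (m + 1), G ((m : ℤ) - m').natAbs
        = ∑ j ∈ Finset.range (m + 1), G j := by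
      rw [← Finset.sum_range_reflect]
      refine Finset.sum_congr rfl fun j hj => ?_
      rw [Finset.mem_range] at hj
      congr 1; omega
    rw [Nat.succ_eq_add_one, h1]
    exact Finset.sum_le_sum_of_subset_of_nonneg (Finset.range_mono hm) fun _ _ _ => hG _
  · rw [Finset.sum_Ico_eq_sum_range]
    have h1 : ∑ j ∈ Finset.range (M - m.succ), G ((m : ℤ) - ((m.succ + j : ℕ) : ℤ)).natAbs
        = ∑ j ∈ Finset.range (M - m.succ), G (j + 1) := by
      refine Finset.sum_congr rfl fun j hj => ?_
      congr 1; omega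
    rw [h1]
    have h2 : ∑ j ∈ Finset.range (M - m.succ), G (j + 1)
        ≤ ∑ j ∈ Finset.range (M - m.succ + 1), G j := by
      rw [Finset.sum_range_succ']; linarith [hG 0]
    refine h2.trans (Finset.sum_le_sum_of_subset_of_nonneg (Finset.range_mono ?_) fun _ _ _ => hG _)
    omega

/-- Each j < L is a difference a - b in at least L ways: b < L arbitrary and a = b + j < 2L.
Completing the sum over j to differences is what later makes the kernel a square. -/
theorem mul_sum_le_sum_sum_sub (L : ℕ) {G : ℤ → ℝ} (hG : ∀ n, 0 ≤ G n) :
    L * ∑ j ∈ Finset.range L, G j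
      ≤ ∑ a ∈ Finset.range (2 * L), ∑ b ∈ Finset.range (2 * L), G ((a : ℤ) - b) := by
  rw [Finset.sum_comm]
  calc (L : ℝ) * ∑ j ∈ Finset.range L, G j
      = ∑ b ∈ Finset.range L, ∑ j ∈ Finset.range L, G j := by simp
    _ ≤ ∑ b ∈ Finset.range L, ∑ a ∈ Finset.range (2 * L), G ((a : ℤ) - b) := by
        refine Finset.sum_le_sum fun b hb => ?_
        rw [Finset.mem_range] at hb
        calc ∑ j ∈ Finset.range L, G j
            = ∑ a ∈ Finset.Ico b (b + L), G ((a : ℤ) - b) := by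
              rw [Finset.sum_Ico_eq_sum_range]; simp
          _ ≤ _ := by
              refine Finset.sum_le_sum_of_subset_of_nonneg ?_ fun _ _ _ => hG _
              intro a ha; rw [Finset.mem_Ico] at ha; rw [Finset.mem_range]; omega
    _ ≤ _ := Finset.sum_le_sum_of_subset_of_nonneg (Finset.range_mono (by omega))
        fun _ _ _ => Finset.sum_nonneg fun _ _ => hG _

/-- Expanding the square and summing over a and b first leaves the nonnegative kernel |∑ₐ e(2a(m -
m')x)|² as coefficient of u_m times the conjugate of u_{m'}. The coefficients u can then be dropped
by the triangle inequality. -/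
theorem sum_sum_norm_sq_sub_le (K M : ℕ) (P : ℤ) (u : ℕ → ℂ) (hu : ∀ m, ‖u m‖ ≤ 1)
    (x : UnitAddCircle) :
    ∑ a ∈ Finset.range K, ∑ b ∈ Finset.range K,
        ‖∑ m ∈ Finset.range M, u m * fourier (((a : ℤ) - b) * (2 * (P + m))) x‖ ^ 2
      ≤ ∑ m ∈ Finset.range M, ∑ m' ∈ Finset.range M,
        ‖∑ a ∈ Finset.range K, fourier ((a : ℤ) * (2 * ((m : ℤ) - m'))) x‖ ^ 2 := by
  have hconj : ∀ z : ℂ, ((‖z‖ ^ 2 : ℝ) : ℂ) = z * (starRingEnd ℂ) z := fun z => by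
    rw [Complex.mul_conj, Complex.normSq_eq_norm_sq]
  have key : ((∑ a ∈ Finset.range K, ∑ b ∈ Finset.range K,
        ‖∑ m ∈ Finset.range M, u m * fourier (((a : ℤ) - b) * (2 * (P + m))) x‖ ^ 2 : ℝ) : ℂ)
      = ∑ m ∈ Finset.range M, ∑ m' ∈ Finset.range M, (u m * (starRingEnd ℂ) (u m')) *
        ((‖∑ a ∈ Finset.range K, fourier ((a : ℤ) * (2 * ((m : ℤ) - m'))) x‖ ^ 2 : ℝ) : ℂ) := by
    rw [Complex.ofReal_sum]
    simp only [Complex.ofReal_sum, hconj, map_sum, Finset.sum_mul_sum]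
    simp only [Finset.mul_sum]
    refine (Finset.sum_congr rfl fun a _ => Finset.sum_comm).trans ?_
    refine Finset.sum_comm.trans (Finset.sum_congr rfl fun m _ => ?_)
    refine (Finset.sum_congr rfl fun a _ => Finset.sum_comm).trans ?_
    refine Finset.sum_comm.trans (Finset.sum_congr rfl fun m' _ => Finset.sum_congr rfl fun a _ =>
      Finset.sum_congr rfl fun b _ => ?_)
    simp only [map_mul, ← fourier_neg]
    rw [mul_mul_mul_comm, ← fourier_add, ← fourier_add]
    congr 3; ring
  have hnn : 0 ≤ ∑ a ∈ Finset.range K, ∑ b ∈ Finset.range K,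
      ‖∑ m ∈ Finset.range M, u m * fourier (((a : ℤ) - b) * (2 * (P + m))) x‖ ^ 2 := by positivity
  rw [← abs_of_nonneg hnn, ← Real.norm_eq_abs, ← Complex.norm_real, key]
  refine (norm_sum_le _ _).trans (Finset.sum_le_sum fun m _ => (norm_sum_le _ _).trans
    (Finset.sum_le_sum fun m' _ => ?_))
  rw [norm_mul, norm_mul, Complex.norm_conj, Complex.norm_real, Real.norm_of_nonneg (by positivity)]
  have : ‖u m‖ * ‖u m'‖ ≤ 1 := mul_le_one₀ (hu m) (norm_nonneg _) (hu m')
  exact mul_le_of_le_one_left (by positivity) this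

/-- Since (P + j + m)² = j² + (P + m)² + 2j(P + m), the shift j enters the inner sum only through a
unimodular factor and a linear phase. Cauchy-Schwarz over j and the two preceding lemmas then apply.
-/
theorem norm_sq_averaged_sum_le (P L M : ℕ) (x : UnitAddCircle) :
    ‖∑ j ∈ Finset.range L, ∑ m ∈ Finset.range M, fourier (((P + j + m : ℕ) : ℤ) ^ 2) x‖ ^ 2
      ≤ 2 * M * ∑ h ∈ Finset.range M,
        ‖∑ a ∈ Finset.range (2 * L), fourier ((a : ℤ) * (2 * (h : ℤ))) x‖ ^ 2 := by
  set g : ℤ → ℂ := fun j => ∑ m ∈ Finset.range M, fourier (((P : ℤ) + m) ^ 2) x *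
    fourier (j * (2 * ((P : ℤ) + m))) x with hg
  have h1 : ∀ j : ℕ, ∑ m ∈ Finset.range M, fourier (((P + j + m : ℕ) : ℤ) ^ 2) x
      = fourier ((j : ℤ) ^ 2) x * g j := by
    intro j
    rw [hg, Finset.mul_sum]
    refine Finset.sum_congr rfl fun m _ => ?_
    rw [← fourier_add, ← fourier_add]
    congr 2; push_cast; ring
  have h2 : ‖∑ j ∈ Finset.range L, ∑ m ∈ Finset.range M,
      fourier (((P + j + m : ℕ) : ℤ) ^ 2) x‖ ≤ ∑ j ∈ Finset.range L, ‖g j‖ := by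
    refine (norm_sum_le _ _).trans (Finset.sum_le_sum fun j _ => ?_)
    rw [h1, norm_mul, norm_fourier_apply, one_mul]
  calc _ ≤ (∑ j ∈ Finset.range L, ‖g j‖) ^ 2 := by gcongr
    _ ≤ L * ∑ j ∈ Finset.range L, ‖g j‖ ^ 2 := by
        simpa using sq_sum_le_card_mul_sum_sq (s := Finset.range L) (f := fun j : ℕ => ‖g j‖)
    _ ≤ ∑ a ∈ Finset.range (2 * L), ∑ b ∈ Finset.range (2 * L), ‖g ((a : ℤ) - b)‖ ^ 2 :=
        mul_sum_le_sum_sum_sub L (G := fun j => ‖g j‖ ^ 2) fun _ => by positivity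
    _ ≤ ∑ m ∈ Finset.range M, ∑ m' ∈ Finset.range M,
        ‖∑ a ∈ Finset.range (2 * L), fourier ((a : ℤ) * (2 * ((m : ℤ) - m'))) x‖ ^ 2 :=
        sum_sum_norm_sq_sub_le _ _ _ _ (fun m => (norm_fourier_apply _ _).le) _
    _ = ∑ m ∈ Finset.range M, ∑ m' ∈ Finset.range M,
        ‖∑ a ∈ Finset.range (2 * L),
          fourier ((a : ℤ) * (2 * ((((m : ℤ) - m').natAbs : ℕ) : ℤ))) x‖ ^ 2 := by
        refine Finset.sum_congr rfl fun m _ => Finset.sum_congr rfl fun m' _ => ?_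
        -- The modulus of the geometric sum is even in m - m', by complex conjugation.
        rcases Int.natAbs_eq ((m : ℤ) - m') with h | h
        · rw [← h]
        · rw [h, Int.natAbs_neg, Int.natAbs_natCast, ← Complex.norm_conj]
          simp only [map_sum, ← fourier_neg]
          congr 2
          refine Finset.sum_congr rfl fun a _ => ?_
          congr 2; ring
    _ ≤ ∑ m ∈ Finset.range M, 2 * ∑ h ∈ Finset.range M,
        ‖∑ a ∈ Finset.range (2 * L), fourier ((a : ℤ) * (2 * (h : ℤ))) x‖ ^ 2 := by
        refine Finset.sum_le_sum fun m hm => ?_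
        exact sum_range_natAbs_sub_le (G := fun h : ℕ => ‖∑ a ∈ Finset.range (2 * L),
          fourier ((a : ℤ) * (2 * (h : ℤ))) x‖ ^ 2) (fun _ => by positivity)
          (Finset.mem_range.1 hm)
    _ = _ := by simp; ring

/-! ### Spacing of the multiples of a point of the torus -/

theorem exists_sum_one_div_one_add_int_sq_le :
    ∃ S : ℝ, 0 < S ∧ ∀ s : Finset ℤ, ∑ i ∈ s, 1 / (1 + (i : ℝ) ^ 2) ≤ S := by
  have hs : Summable fun i : ℤ => 1 / (1 + (i : ℝ) ^ 2) := by
    refine Summable.of_norm_bounded_eventually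
      (Real.summable_one_div_int_pow.2 one_lt_two) ?_
    have : ∀ᶠ i : ℤ in Filter.cofinite, i ≠ 0 := by
      rw [Filter.eventually_cofinite]
      simp
    filter_upwards [this] with i hi
    have : (0 : ℝ) < (i : ℝ) ^ 2 := by positivity
    rw [Real.norm_of_nonneg (by positivity)]
    exact one_div_le_one_div_of_le this (by linarith)
  refine ⟨∑' i : ℤ, 1 / (1 + (i : ℝ) ^ 2), hs.tsum_pos (fun _ => by positivity) 0 (by norm_num),
    fun s => hs.sum_le_tsum s fun _ _ => by positivity⟩

/-- The integer da - bq equals q(dt - b) - d(qt - a), of size at most 1/2 + 1/4 < 1, so it vanishes;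
coprimality gives q ∣ d, and then b = ja. -/
theorem exists_eq_mul_of_abs_mul_sub_lt {N q d : ℕ} {a b : ℤ} {t : ℝ} (hN : 0 < N) (hq : 0 < q)
    (hqN : q ≤ 4 * N) (hd : d < N) (hcop : IsCoprime a (q : ℤ))
    (ht : |q * t - a| ≤ 1 / (4 * N)) (hb : |d * t - b| < 1 / (8 * N)) :
    ∃ j : ℕ, d = j * q ∧ j * |q * t - a| < 1 / (8 * N) := by
  have hN' : (0 : ℝ) < N := by exact_mod_cast hN
  have hqN' : (q : ℝ) ≤ 4 * N := by exact_mod_cast hqN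
  have hq' : (0 : ℝ) < q := by exact_mod_cast hq
  have hd' : (d : ℝ) < N := by exact_mod_cast hd
  have hzero : (d : ℤ) * a = b * q := by
    have hlt : |((d * a - b * q : ℤ) : ℝ)| < 1 := by
      have he : ((d * a - b * q : ℤ) : ℝ) = q * (d * t - b) - d * (q * t - a) := by
        push_cast; ring
      rw [he]
      refine (abs_sub _ _).trans_lt ?_
      rw [abs_mul, abs_mul, Nat.abs_cast, Nat.abs_cast]
      have h1 : (q : ℝ) * |d * t - b| ≤ 4 * N * (1 / (8 * N)) := by gcongr
      have h2 : (d : ℝ) * |q * t - a| ≤ N * (1 / (4 * N)) := by gcongr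
      have e1 : 4 * (N : ℝ) * (1 / (8 * N)) = 1 / 2 := by field_simp; norm_num
      have e2 : (N : ℝ) * (1 / (4 * N)) = 1 / 4 := by field_simp
      linarith
    have h0 : (d * a - b * q : ℤ) = 0 := by
      rw [← Int.cast_abs] at hlt
      exact Int.abs_lt_one_iff.1 (by exact_mod_cast hlt)
    linarith
  have hdvd : (q : ℤ) ∣ d := hcop.symm.dvd_of_dvd_mul_right ⟨b, by rw [hzero]; ring⟩
  obtain ⟨j, hj⟩ := Int.natCast_dvd_natCast.1 hdvd
  refine ⟨j, by rw [hj, mul_comm], ?_⟩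
  have hbj : b = j * a := by
    have hq0 : (q : ℤ) ≠ 0 := by exact_mod_cast hq.ne'
    apply mul_right_cancel₀ hq0
    rw [← hzero, hj]; push_cast; ring
  rw [hj, hbj] at hb
  have : ((q * j : ℕ) : ℝ) * t - ((j * a : ℤ) : ℝ) = j * (q * t - a) := by push_cast; ring
  rwa [this, abs_mul, Nat.abs_cast] at hb

/-- F lies in a progression of step q starting at its minimum and having J + 1 terms. Both Jq ≤ N
and JN²δ ≤ N/8 hold; adding them bounds J. -/
theorem card_le_of_forall_exists_sub_eq_mul {F : Finset ℕ} {N q : ℕ} {δ : ℝ} (hq : 0 < q)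
    (hF : ∀ h ∈ F, h < N) (hN : 0 < N) (hδ : 0 ≤ δ)
    (hsub : ∀ h ∈ F, ∀ h' ∈ F, h ≤ h' → ∃ j : ℕ, h' - h = j * q ∧ j * δ < 1 / (8 * N)) :
    (F.card : ℝ) ≤ 1 + 2 * N / (q + N ^ 2 * δ) := by
  have hN' : (0 : ℝ) < N := by exact_mod_cast hN
  have hq' : (0 : ℝ) < q := by exact_mod_cast hq
  have hden : (0 : ℝ) < q + N ^ 2 * δ := by positivity
  rcases F.eq_empty_or_nonempty with rfl | hne
  · simp; positivity
  obtain ⟨J, hJ, hJδ⟩ := hsub _ (F.min'_mem hne) _ (F.max'_mem hne) (F.min'_le_max' hne)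
  have hcard : F.card ≤ J + 1 := by
    have hsubset : F ⊆ (Finset.range (J + 1)).image fun j => F.min' hne + j * q := by
      intro h hh
      obtain ⟨j, hj, -⟩ := hsub _ (F.min'_mem hne) h hh (F.min'_le h hh)
      have h1 := F.min'_le h hh
      have h2 := F.le_max' h hh
      refine Finset.mem_image.2 ⟨j, Finset.mem_range.2 (Nat.lt_succ_of_le ?_), by omega⟩
      refine Nat.le_of_mul_le_mul_right ?_ hq
      omega
    simpa using (Finset.card_le_card hsubset).trans Finset.card_image_le
  have hJq : (J : ℝ) * q ≤ N := by
    have := hF _ (F.max'_mem hne)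
    exact_mod_cast (show J * q ≤ N by omega)
  have hJ2 : (J : ℝ) ≤ 2 * N / (q + N ^ 2 * δ) := by
    rw [le_div_iff₀ hden]
    have h1 : (N : ℝ) ^ 2 * (J * δ) ≤ N ^ 2 * (1 / (8 * N)) := by gcongr
    have e1 : (N : ℝ) ^ 2 * (1 / (8 * N)) = N / 8 := by field_simp
    nlinarith
  have : (F.card : ℝ) ≤ J + 1 := by exact_mod_cast hcard
  linarith

/-- The h < N are sorted by the cell of width 1/(8N) containing the signed distance of ht to the
nearest integer. In cell i the bound on D² is of order N²/(1 + i²), which is summable, and each cell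
holds at most 1 + 2N/(q + N²‖qy‖) values of h. The denominator q is chosen before D, from y and N
alone. -/
theorem exists_sum_sq_le_of_mul_norm_nsmul_le :
    ∃ C : ℝ, 0 < C ∧ ∀ (N : ℕ) (y : UnitAddCircle), 0 < N → ∃ q : ℕ, 0 < q ∧ q ≤ 4 * N ∧
      ∀ D : ℕ → ℝ, (∀ h, 0 ≤ D h) → (∀ h, D h ≤ N) → (∀ h, D h * ‖h • y‖ ≤ 1 / 2) →
        ∑ h ∈ Finset.range N, D h ^ 2 ≤ C * N * (N + N ^ 2 / (q + N ^ 2 * ‖q • y‖)) := by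
  obtain ⟨S, hS, hsum⟩ := exists_sum_one_div_one_add_int_sq_le
  refine ⟨70 * S, by positivity, fun N y hN => ?_⟩
  have hN' : (0 : ℝ) < N := by exact_mod_cast hN
  obtain ⟨t, ht, -, -⟩ := y.exists_coe_eq_abs_eq_norm
  obtain ⟨r, hr, hrN⟩ := Real.exists_rat_abs_sub_le_and_den_le t (n := 4 * N) (by omega)
  have hqpos := r.den_pos
  have hq' : (0 : ℝ) < r.den := by exact_mod_cast hqpos
  have hnear : |r.den * t - r.num| ≤ 1 / (4 * N) := by
    have h1 : (r.den : ℝ) * t - r.num = r.den * (t - r) := by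
      have : (r : ℝ) = r.num / r.den := by exact_mod_cast (Rat.num_div_den r).symm
      rw [this]; field_simp
    rw [h1, abs_mul, Nat.abs_cast]
    calc (r.den : ℝ) * |t - r| ≤ r.den * (1 / (((4 * N : ℕ) + 1) * r.den)) := by gcongr
      _ = 1 / ((4 * N : ℕ) + 1) := by field_simp
      _ ≤ 1 / (4 * N) := by
        apply one_div_le_one_div_of_le (by positivity); push_cast; linarith
  have hcop : IsCoprime r.num (r.den : ℤ) := Rat.isCoprime_num_den r
  refine ⟨r.den, hqpos, hrN, fun D hD0 hDN hD => ?_⟩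
  have hnorm : ∀ h : ℕ, ‖h • y‖ = |h * t - round (h * t)| := fun h => by
    rw [← ht, ← AddCircle.coe_nsmul, UnitAddCircle.norm_eq, nsmul_eq_mul]
  have hδ : ‖r.den • y‖ ≤ |r.den * t - r.num| := by
    rw [hnorm]; exact round_le _ _
  set idx : ℕ → ℤ := fun h => ⌊8 * N * (h * t - round (h * t))⌋ with hidx
  have hterm : ∀ h ∈ Finset.range N, D h ^ 2 ≤ 35 * N ^ 2 * (1 / (1 + (idx h : ℝ) ^ 2)) := by
    intro h _
    have hden : (0 : ℝ) < 1 + (idx h : ℝ) ^ 2 := by positivity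
    rw [mul_one_div, le_div_iff₀ hden]
    set u := (h : ℝ) * t - round (h * t)
    have hDu := hD h
    rw [hnorm] at hDu
    have h1 : ((idx h : ℤ) : ℝ) ≤ 8 * N * u := Int.floor_le _
    have h2 : 8 * N * u < idx h + 1 := Int.lt_floor_add_one _
    have h3 : (idx h : ℝ) ^ 2 ≤ 2 * (8 * N * u) ^ 2 + 2 := by
      generalize 8 * N * u = v at h1 h2
      nlinarith [sq_nonneg (2 * v - idx h), mul_nonneg (sub_nonneg.2 h1) (sub_nonneg.2 h2.le)]
    have h4 : D h ^ 2 * u ^ 2 ≤ 1 / 4 := by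
      rw [← sq_abs u, ← mul_pow]
      calc (D h * |u|) ^ 2 ≤ (1 / 2) ^ 2 := by
            have := hD0 h
            gcongr
        _ = 1 / 4 := by norm_num
    have h5 : D h ^ 2 ≤ N ^ 2 := by
      have := hD0 h
      have := hDN h
      gcongr
    calc D h ^ 2 * (1 + (idx h : ℝ) ^ 2) ≤ D h ^ 2 * (1 + (2 * (8 * N * u) ^ 2 + 2)) := by gcongr
      _ = 3 * D h ^ 2 + 128 * N ^ 2 * (D h ^ 2 * u ^ 2) := by ring
      _ ≤ 3 * N ^ 2 + 128 * N ^ 2 * (1 / 4) := by gcongr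
      _ = 35 * N ^ 2 := by ring
  have hfib : ∀ i : ℤ, (((Finset.range N).filter fun h => idx h = i).card : ℝ)
      ≤ 1 + 2 * N / (r.den + N ^ 2 * ‖r.den • y‖) := by
    intro i
    refine card_le_of_forall_exists_sub_eq_mul hqpos
      (fun h hh => Finset.mem_range.1 (Finset.mem_filter.1 hh).1) hN (norm_nonneg _) ?_
    intro h hh h' hh' hle
    rw [Finset.mem_filter, Finset.mem_range] at hh hh'
    have hclose : |((h' - h : ℕ) : ℝ) * t - ((round (h' * t) - round (h * t) : ℤ) : ℝ)|
        < 1 / (8 * N) := by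
      have hab := Int.abs_sub_lt_one_of_floor_eq_floor (hh'.2.trans hh.2.symm)
      rw [← mul_sub, abs_mul, abs_of_pos (by positivity : (0 : ℝ) < 8 * N)] at hab
      rw [lt_div_iff₀ (by positivity), mul_comm]
      refine lt_of_eq_of_lt ?_ hab
      congr 2
      rw [Nat.cast_sub hle]; push_cast; ring
    obtain ⟨j, hj, hjδ⟩ := exists_eq_mul_of_abs_mul_sub_lt hN hqpos hrN
      (lt_of_le_of_lt (Nat.sub_le _ _) hh'.1) hcop hnear hclose
    exact ⟨j, hj, lt_of_le_of_lt (by gcongr) hjδ⟩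
  set φ := (N : ℝ) ^ 2 / (r.den + N ^ 2 * ‖r.den • y‖) with hφ
  have hφ0 : 0 ≤ φ := by positivity
  have hφ' : 2 * (N : ℝ) / (r.den + N ^ 2 * ‖r.den • y‖) = 2 * φ / N := by
    rw [hφ]; field_simp
  calc ∑ h ∈ Finset.range N, D h ^ 2
      ≤ ∑ h ∈ Finset.range N, 35 * N ^ 2 * (1 / (1 + (idx h : ℝ) ^ 2)) := Finset.sum_le_sum hterm
    _ = 35 * N ^ 2 * ∑ h ∈ Finset.range N, 1 / (1 + (idx h : ℝ) ^ 2) := by rw [Finset.mul_sum]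
    _ = 35 * N ^ 2 * ∑ i ∈ (Finset.range N).image idx,
          ((Finset.range N).filter fun h => idx h = i).card • (1 / (1 + (i : ℝ) ^ 2)) := by
        rw [Finset.sum_comp (fun i : ℤ => 1 / (1 + (i : ℝ) ^ 2)) idx]
    _ ≤ 35 * N ^ 2 * ∑ i ∈ (Finset.range N).image idx,
          (1 + 2 * φ / N) * (1 / (1 + (i : ℝ) ^ 2)) := by
        gcongr with i hi
        rw [nsmul_eq_mul, ← hφ']
        gcongr
        exact hfib i
    _ ≤ 35 * N ^ 2 * ((1 + 2 * φ / N) * S) := by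
        rw [← Finset.mul_sum]; gcongr; exact hsum _
    _ = 35 * S * N * (N + 2 * φ) := by field_simp
    _ ≤ 35 * S * N * (2 * (N + φ)) := by gcongr; linarith
    _ = 70 * S * N * (N + φ) := by ring

/-! ### The rate `‖K_N‖_p` -/

/-- The order of magnitude of `‖K_N‖_p`. -/
noncomputable def gaussRate (p : ℝ) (N : ℕ) : ℝ :=
  if p < 4 then (N : ℝ) ^ (1 / 2 : ℝ)
  else if p = 4 then (N : ℝ) ^ (1 / 2 : ℝ) * (1 + Real.log N) ^ (1 / 4 : ℝ)
  else (N : ℝ) ^ (1 - 2 / p)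

theorem gaussRate_nonneg (p : ℝ) (N : ℕ) : 0 ≤ gaussRate p N := by
  have := Real.log_natCast_nonneg N
  unfold gaussRate; split_ifs <;> positivity

theorem half_le_one_sub_two_div {p : ℝ} (hp : 4 ≤ p) : 1 / 2 ≤ 1 - 2 / p := by
  have : 2 / p ≤ 1 / 2 := by rw [div_le_iff₀ (by linarith)]; linarith
  linarith

theorem natCast_log_mono {j N : ℕ} (h : j ≤ N) : Real.log j ≤ Real.log N := by
  rcases Nat.eq_zero_or_pos j with rfl | hj
  · simpa using Real.log_natCast_nonneg N
  · exact Real.log_le_log (by exact_mod_cast hj) (by exact_mod_cast h)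

theorem gaussRate_mono {p : ℝ} {j N : ℕ} (h : j ≤ N) : gaussRate p j ≤ gaussRate p N := by
  have hjN : (j : ℝ) ≤ N := by exact_mod_cast h
  have h1 := Real.log_natCast_nonneg j
  have h2 := natCast_log_mono h
  unfold gaussRate
  split_ifs with h4 h5
  · gcongr
  · gcongr
  · have := half_le_one_sub_two_div (not_lt.1 h4)
    gcongr

/-- The factor matters: 8^(1/2) ≥ 8/3, and two pieces at 3/8 each total 3/4 < 1, so the induction on
the length closes. -/
theorem rpow_le_mul_rpow_of_eight_mul_le {a : ℝ} (ha : 1 / 2 ≤ a) {x y : ℝ} (hx : 0 ≤ x)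
    (h : 8 * x ≤ y) : x ^ a ≤ 3 / 8 * y ^ a := by
  have h8 : (8 : ℝ) ^ (1 / 2 : ℝ) ≤ 8 ^ a := Real.rpow_le_rpow_of_exponent_le (by norm_num) ha
  have h83 : (8 / 3 : ℝ) ≤ 8 ^ (1 / 2 : ℝ) := by
    rw [← Real.sqrt_eq_rpow]; exact Real.le_sqrt_of_sq_le (by norm_num)
  have h1 : (8 * x) ^ a ≤ y ^ a := by gcongr
  rw [Real.mul_rpow (by norm_num) hx] at h1
  have h2 : 8 / 3 * x ^ a ≤ 8 ^ a * x ^ a := by gcongr; linarith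
  linarith

theorem gaussRate_le_of_eight_mul_le {p : ℝ} {j N : ℕ} (h : 8 * j ≤ N) :
    gaussRate p j ≤ 3 / 8 * gaussRate p N := by
  have hjN : 8 * (j : ℝ) ≤ N := by exact_mod_cast h
  have h1 := Real.log_natCast_nonneg j
  have h2 : Real.log j ≤ Real.log N := natCast_log_mono (by omega)
  unfold gaussRate
  split_ifs with h4 h5
  · exact rpow_le_mul_rpow_of_eight_mul_le le_rfl (by positivity) hjN
  · rw [← mul_assoc]
    gcongr
    exact rpow_le_mul_rpow_of_eight_mul_le le_rfl (by positivity) hjN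
  · exact rpow_le_mul_rpow_of_eight_mul_le (half_le_one_sub_two_div (not_lt.1 h4))
      (by positivity) hjN

theorem rpow_half_le_gaussRate (p : ℝ) {N : ℕ} (hN : 0 < N) :
    (N : ℝ) ^ (1 / 2 : ℝ) ≤ gaussRate p N := by
  have h1 := Real.log_natCast_nonneg N
  have hN' : (1 : ℝ) ≤ N := by exact_mod_cast hN
  unfold gaussRate
  split_ifs with h4 h5
  · rfl
  · exact le_mul_of_one_le_right (by positivity) (Real.one_le_rpow (by linarith) (by norm_num))
  · exact Real.rpow_le_rpow_of_exponent_le hN' (half_le_one_sub_two_div (not_lt.1 h4))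

theorem sum_rpow_neg_le {a : ℝ} (ha0 : 0 ≤ a) (ha : a < 1) (Q : ℕ) :
    ∑ q ∈ Finset.Icc 1 Q, (q : ℝ) ^ (-a) ≤ (Q : ℝ) ^ (1 - a) / (1 - a) := by
  have h1a : 0 < 1 - a := by linarith
  induction Q with
  | zero => simp [Real.zero_rpow h1a.ne']
  | succ Q ih =>
    rw [Finset.sum_Icc_succ_top (by omega)]
    have hQ : (0 : ℝ) < (Q + 1 : ℕ) := by positivity
    -- Bernoulli's inequality for the exponent 1 - a replaces the comparison with an integral:
    -- (Q/(Q+1))^(1-a) ≤ 1 - (1-a)/(Q+1).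
    have hb := rpow_one_add_le_one_add_mul_self (s := -(1 / ((Q + 1 : ℕ) : ℝ))) (p := 1 - a)
      (by rw [neg_le_neg_iff, div_le_one hQ]; push_cast; linarith [(Nat.cast_nonneg Q : (0:ℝ) ≤ Q)])
      h1a.le (by linarith)
    have e1 : 1 + -(1 / ((Q + 1 : ℕ) : ℝ)) = Q / (Q + 1 : ℕ) := by
      field_simp; push_cast; ring
    rw [e1, Real.div_rpow (by positivity) hQ.le, div_le_iff₀ (by positivity)] at hb
    have e2 : ((Q + 1 : ℕ) : ℝ) ^ (-a) = ((Q + 1 : ℕ) : ℝ) ^ (1 - a) / (Q + 1 : ℕ) := by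
      rw [← Real.rpow_sub_one hQ.ne']; congr 1; ring
    have hkey : (Q : ℝ) ^ (1 - a) / (1 - a) + ((Q + 1 : ℕ) : ℝ) ^ (-a)
        ≤ ((Q + 1 : ℕ) : ℝ) ^ (1 - a) / (1 - a) := by
      rw [e2, le_div_iff₀ h1a, add_mul, div_mul_cancel₀ _ h1a.ne']
      refine (add_le_add_left hb _).trans (le_of_eq ?_)
      field_simp; ring
    linarith

/-- The exponent of 1/q is p/2 - 1. Below 1 the sum is governed by its upper end, at 1 it is
harmonic, above 1 it converges; these are the three cases of `gaussRate`. -/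
theorem exists_sum_rpow_le_gaussRate_rpow {p : ℝ} (hp : 3 ≤ p) :
    ∃ C : ℝ, 0 < C ∧ ∀ N : ℕ, 0 < N →
      ∑ q ∈ Finset.Icc 1 (4 * N), ((N : ℝ) ^ 2 / q) ^ (p / 2 - 1) ≤ C * gaussRate p N ^ p := by
  suffices h : ∃ C : ℝ, 0 < C ∧ ∀ N : ℕ, 0 < N →
      (N : ℝ) ^ (p - 2) * ∑ q ∈ Finset.Icc 1 (4 * N), (q : ℝ) ^ (-(p / 2 - 1))
        ≤ C * gaussRate p N ^ p by
    obtain ⟨C, hC, h⟩ := h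
    refine ⟨C, hC, fun N hN => (le_of_eq ?_).trans (h N hN)⟩
    rw [Finset.mul_sum]
    refine Finset.sum_congr rfl fun q hq => ?_
    rw [Real.div_rpow (by positivity) (by positivity), Real.rpow_neg (by positivity),
      div_eq_mul_inv, ← Real.rpow_natCast, ← Real.rpow_mul (by positivity)]
    congr 2; push_cast; ring
  rcases lt_trichotomy p 4 with h4 | h4 | h4
  · refine ⟨4 ^ (1 - (p / 2 - 1)) / (1 - (p / 2 - 1)), ?_, fun N hN => ?_⟩
    · have : 0 < 1 - (p / 2 - 1) := by linarith
      positivity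
    · have hN' : (0 : ℝ) < N := by exact_mod_cast hN
      have h := sum_rpow_neg_le (a := p / 2 - 1) (by linarith) (by linarith) (4 * N)
      rw [gaussRate, if_pos h4, ← Real.rpow_mul hN'.le]
      refine (mul_le_mul_of_nonneg_left h (by positivity)).trans (le_of_eq ?_)
      push_cast
      rw [Real.mul_rpow (by norm_num) hN'.le, mul_comm, mul_div_right_comm, mul_assoc,
        ← Real.rpow_add hN']
      congr 2; ring
  · subst h4
    refine ⟨1 + Real.log 4, by have := Real.log_nonneg (x := 4) (by norm_num); linarith,
      fun N hN => ?_⟩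
    have hN' : (0 : ℝ) < N := by exact_mod_cast hN
    have hlog := Real.log_natCast_nonneg N
    have hlog4 := Real.log_nonneg (x := 4) (by norm_num)
    have hh := harmonic_le_one_add_log (4 * N)
    rw [harmonic_eq_sum_Icc] at hh
    push_cast at hh
    rw [Real.log_mul (by norm_num) hN'.ne'] at hh
    have e : ∀ q : ℕ, (q : ℝ) ^ (-((4 : ℝ) / 2 - 1)) = (q : ℝ)⁻¹ := fun q => by
      rw [show -((4 : ℝ) / 2 - 1) = -1 by norm_num, Real.rpow_neg_one]
    simp only [e]
    rw [gaussRate, if_neg (lt_irrefl _), if_pos rfl, Real.mul_rpow (by positivity) (by positivity),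
      ← Real.rpow_mul hN'.le, ← Real.rpow_mul (by positivity),
      show (1 / 2 * 4 : ℝ) = 4 - 2 by norm_num, show (1 / 4 * 4 : ℝ) = 1 by norm_num, Real.rpow_one]
    rw [mul_left_comm]
    gcongr
    nlinarith
  · have hs : Summable fun q : ℕ => (q : ℝ) ^ (-(p / 2 - 1)) :=
      Real.summable_nat_rpow.2 (by linarith)
    refine ⟨∑' q : ℕ, (q : ℝ) ^ (-(p / 2 - 1)), ?_, fun N hN => ?_⟩
    · exact hs.tsum_pos (fun _ => by positivity) 1 (by simp)
    · have hN' : (0 : ℝ) < N := by exact_mod_cast hN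
      rw [gaussRate, if_neg h4.not_gt, if_neg h4.ne', ← Real.rpow_mul hN'.le, mul_comm,
        show (1 - 2 / p) * p = p - 2 by field_simp]
      gcongr
      exact hs.sum_le_tsum _ fun _ _ => by positivity

/-! ### The upper bound for averaged sums -/

theorem continuousAt_div_one_add_mul_rpow {B r t : ℝ} (hr : 0 ≤ r) (h0 : 0 < 1 + B * t) :
    ContinuousAt (fun t => (B / (1 + B * t)) ^ r) t :=
  ContinuousAt.rpow_const (f := fun t => B / (1 + B * t))
    (ContinuousAt.div (by fun_prop) (by fun_prop) h0.ne') (Or.inr hr)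

theorem integral_zero_half_div_rpow_le {B r : ℝ} (hB : 0 < B) (hr : 1 < r) :
    ∫ t in (0 : ℝ)..(1 / 2), (B / (1 + B * t)) ^ r ≤ B ^ (r - 1) / (r - 1) := by
  have hr1 : 0 < r - 1 := by linarith
  have hpos : ∀ t ∈ Set.uIcc (0 : ℝ) (1 / 2), 0 < 1 + B * t := by
    intro t ht
    rw [Set.uIcc_of_le (by norm_num)] at ht
    have := mul_nonneg hB.le ht.1
    linarith
  have hderiv : ∀ t ∈ Set.uIcc (0 : ℝ) (1 / 2),
      HasDerivAt (fun t => -(B ^ (r - 1) / (r - 1)) * (1 + B * t) ^ (1 - r))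
        ((B / (1 + B * t)) ^ r) t := by
    intro t ht
    have h0 := hpos t ht
    have h1 : HasDerivAt (fun t : ℝ => 1 + B * t) B t := by
      simpa using ((hasDerivAt_id t).const_mul B).const_add 1
    have h2 := (h1.rpow_const (p := 1 - r) (Or.inl h0.ne')).const_mul (-(B ^ (r - 1) / (r - 1)))
    refine h2.congr_deriv ?_
    rw [Real.div_rpow hB.le h0.le, show 1 - r - 1 = -r by ring, Real.rpow_neg h0.le,
      Real.rpow_sub_one hB.ne']
    field_simp
    ring
  have hint : IntervalIntegrable (fun t => (B / (1 + B * t)) ^ r) volume 0 (1 / 2) :=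
    ContinuousOn.intervalIntegrable fun t ht =>
      (continuousAt_div_one_add_mul_rpow (by linarith) (hpos t ht)).continuousWithinAt
  rw [intervalIntegral.integral_eq_sub_of_hasDerivAt hderiv hint]
  have h1 : 0 ≤ B ^ (r - 1) / (r - 1) * (1 + B * (1 / 2)) ^ (1 - r) := by positivity
  simp only [mul_zero, add_zero, Real.one_rpow]
  linarith

theorem integral_comp_norm_unitAddCircle {g : ℝ → ℝ} (hg : ContinuousOn g (Set.Ici 0)) :
    ∫ x : UnitAddCircle, g ‖x‖ = 2 * ∫ t in (0 : ℝ)..(1 / 2), g t := by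
  have hpos : ∫ t in (0 : ℝ)..(1 / 2), g ‖(t : UnitAddCircle)‖ = ∫ t in (0 : ℝ)..(1 / 2), g t := by
    refine intervalIntegral.integral_congr fun t ht => ?_
    rw [Set.uIcc_of_le (by norm_num)] at ht
    have : ‖(t : UnitAddCircle)‖ = t := by
      rw [(AddCircle.norm_coe_eq_abs_iff 1 one_ne_zero).2, abs_of_nonneg ht.1]
      rw [abs_of_nonneg ht.1, abs_one]; exact ht.2
    simp only [this]
  have hneg : ∫ t in (-(1 / 2) : ℝ)..0, g ‖(t : UnitAddCircle)‖
      = ∫ t in (0 : ℝ)..(1 / 2), g ‖(t : UnitAddCircle)‖ := by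
    have := intervalIntegral.integral_comp_neg (a := (0 : ℝ)) (b := 1 / 2)
      fun t => g ‖(t : UnitAddCircle)‖
    rw [neg_zero] at this
    rw [← this]
    simp only [AddCircle.coe_neg, norm_neg]
  have hcont : Continuous fun x : UnitAddCircle => g ‖x‖ :=
    hg.comp_continuous continuous_norm fun x => norm_nonneg x
  have hcont' : Continuous fun t : ℝ => g ‖(t : UnitAddCircle)‖ :=
    hcont.comp (AddCircle.continuous_mk' 1)
  rw [← UnitAddCircle.intervalIntegral_preimage (-(1 / 2)) fun x => g ‖x‖,
    show (-(1 / 2) + 1 : ℝ) = 1 / 2 by norm_num,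
    ← intervalIntegral.integral_add_adjacent_intervals (b := 0)
      (hcont'.intervalIntegrable _ _) (hcont'.intervalIntegrable _ _), hneg, hpos, two_mul]

theorem integral_comp_nsmul_unitAddCircle {n : ℕ} (hn : 1 < n) {f : UnitAddCircle → ℝ}
    (hf : Continuous f) : ∫ x, f (n • x) = ∫ x, f x := by
  have hmp := (AddCircle.ergodic_nsmul (T := 1) hn).toMeasurePreserving
  conv_rhs => rw [← hmp.map_eq]
  rw [integral_map hmp.measurable.aemeasurable hf.aestronglyMeasurable]

theorem continuous_div_add_mul_norm_rpow {N q n : ℕ} (hq : 0 < q) {r : ℝ} (hr : 0 ≤ r) :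
    Continuous fun x : UnitAddCircle => ((N : ℝ) ^ 2 / (q + N ^ 2 * ‖n • x‖)) ^ r := by
  have hq' : (0 : ℝ) < q := by exact_mod_cast hq
  refine Continuous.rpow_const (Continuous.div (by fun_prop) (by fun_prop) fun x => ?_)
    fun x => Or.inr hr
  positivity

/-- Invariance under x ↦ 2qx replaces the spikes at all the rationals with denominator 2q by a
single spike at 0, integrated explicitly with B = N²/q. -/
theorem integral_div_add_mul_norm_rpow_le {N q : ℕ} (hN : 0 < N) (hq : 0 < q) {r : ℝ}
    (hr : 1 < r) :
    ∫ x : UnitAddCircle, ((N : ℝ) ^ 2 / (q + N ^ 2 * ‖(q * 2) • x‖)) ^ r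
      ≤ 2 / (r - 1) * ((N : ℝ) ^ 2 / q) ^ (r - 1) := by
  have hq' : (0 : ℝ) < q := by exact_mod_cast hq
  have hN' : (0 : ℝ) < N := by exact_mod_cast hN
  have hc := continuous_div_add_mul_norm_rpow (N := N) (n := 1) hq (r := r) (by linarith)
  simp only [one_smul] at hc
  rw [integral_comp_nsmul_unitAddCircle (n := q * 2) (by omega) hc]
  set B := (N : ℝ) ^ 2 / q with hB
  have hB0 : 0 < B := by positivity
  have e : ∀ x : UnitAddCircle, (N : ℝ) ^ 2 / (q + N ^ 2 * ‖x‖) = B / (1 + B * ‖x‖) := by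
    intro x
    have : 0 ≤ ‖x‖ := norm_nonneg x
    rw [hB]; field_simp
  simp only [e]
  rw [integral_comp_norm_unitAddCircle (g := fun t => (B / (1 + B * t)) ^ r)]
  · have := integral_zero_half_div_rpow_le hB0 hr
    calc _ ≤ 2 * (B ^ (r - 1) / (r - 1)) := by gcongr
      _ = _ := by ring
  · intro t ht
    have ht' : (0 : ℝ) ≤ t := ht
    have h0 : 0 < 1 + B * t := by positivity
    exact (continuousAt_div_one_add_mul_rpow (by linarith) h0).continuousWithinAt

/-- The average over `j < L` of the sums of `e^{2πi n² x}` over `P + j ≤ n < P + j + M`. -/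
noncomputable def averagedSum (P L M : ℕ) (x : UnitAddCircle) : ℂ :=
  (L : ℂ)⁻¹ * ∑ j ∈ Finset.range L, ∑ m ∈ Finset.range M, fourier (((P + j + m : ℕ) : ℤ) ^ 2) x

theorem continuous_averagedSum (P L M : ℕ) : Continuous (averagedSum P L M) :=
  continuous_const.mul (continuous_finsetSum _ fun _ _ =>
    continuous_finsetSum _ fun _ _ => continuous_fourier _)

theorem exists_norm_sq_averagedSum_le :
    ∃ C : ℝ, 0 < C ∧ ∀ (P N : ℕ) (x : UnitAddCircle), 8 ≤ N → ∃ q ∈ Finset.Icc 1 (4 * N),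
      ‖averagedSum P (N / 8) (N - N / 8) x‖ ^ 2
        ≤ C * (N + N ^ 2 / (q + N ^ 2 * ‖(q * 2) • x‖)) := by
  obtain ⟨C, hC, h⟩ := exists_sum_sq_le_of_mul_norm_nsmul_le
  -- 512 = 2 · 16²: the factor 2 comes from differencing, and N ≤ 16L for L = N/8 rounded down.
  refine ⟨512 * C, by positivity, fun P N x hN => ?_⟩
  obtain ⟨q, hq, hqN, hD⟩ := h N (2 • x) (by omega)
  refine ⟨q, Finset.mem_Icc.2 ⟨hq, hqN⟩, ?_⟩
  set L := N / 8 with hL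
  have hL1 : (N : ℝ) ≤ 16 * L := by exact_mod_cast (show N ≤ 16 * (N / 8) by omega)
  have hN' : (8 : ℝ) ≤ N := by exact_mod_cast hN
  have hL0 : (0 : ℝ) < L := by linarith
  have hW := norm_sq_averaged_sum_le P L (N - L) x
  have hS := hD (fun h => ‖∑ a ∈ Finset.range (2 * L), fourier ((a : ℤ) * (2 * (h : ℤ))) x‖)
    (fun _ => norm_nonneg _)
    (fun h => (norm_sum_fourier_mul_le _ _ _).trans (by exact_mod_cast (by omega)))
    (fun h => by
      have := norm_sum_fourier_mul_mul_norm_le (2 * L) (2 * (h : ℤ)) x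
      have e : (2 * (h : ℤ)) • x = h • (2 • x) := by
        rw [smul_smul, ← natCast_zsmul]; congr 1; push_cast; ring
      rwa [e] at this)
  rw [smul_smul] at hS
  set φ := (N : ℝ) ^ 2 / (q + N ^ 2 * ‖(q * 2) • x‖) with hφ
  have hφ0 : 0 ≤ φ := by positivity
  have hle : ∑ h ∈ Finset.range (N - L),
        ‖∑ a ∈ Finset.range (2 * L), fourier ((a : ℤ) * (2 * (h : ℤ))) x‖ ^ 2
      ≤ C * N * (N + φ) :=
    (Finset.sum_le_sum_of_subset_of_nonneg (Finset.range_mono (by omega))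
      fun _ _ _ => by positivity).trans hS
  have hNL : ((N - L : ℕ) : ℝ) ≤ N := by exact_mod_cast Nat.sub_le _ _
  rw [averagedSum, norm_mul, mul_pow, norm_inv, Complex.norm_natCast, inv_pow,
    inv_mul_le_iff₀ (by positivity)]
  calc _ ≤ 2 * (N - L : ℕ) * (C * N * (N + φ)) := hW.trans (by gcongr)
    _ ≤ 2 * N * (C * N * (N + φ)) := by gcongr
    _ = 2 * C * (N + φ) * N ^ 2 := by ring
    _ ≤ 2 * C * (N + φ) * (16 * L) ^ 2 := by gcongr
    _ = _ := by ring

theorem add_rpow_le_two_rpow_mul {a b r : ℝ} (ha : 0 ≤ a) (hb : 0 ≤ b) (hr : 0 ≤ r) :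
    (a + b) ^ r ≤ 2 ^ r * (a ^ r + b ^ r) := by
  rcases le_total a b with h | h
  · calc (a + b) ^ r ≤ (2 * b) ^ r := by gcongr; linarith
      _ = 2 ^ r * b ^ r := Real.mul_rpow (by norm_num) hb
      _ ≤ _ := by gcongr; have := Real.rpow_nonneg ha r; linarith
  · calc (a + b) ^ r ≤ (2 * a) ^ r := by gcongr; linarith
      _ = 2 ^ r * a ^ r := Real.mul_rpow (by norm_num) ha
      _ ≤ _ := by gcongr; have := Real.rpow_nonneg hb r; linarith

theorem exists_torusNorm_averagedSum_le {p : ℝ} (hp : 3 ≤ p) :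
    ∃ C : ℝ, 0 < C ∧ ∀ P N : ℕ, 8 ≤ N →
      torusNorm p (averagedSum P (N / 8) (N - N / 8)) ≤ C * gaussRate p N := by
  obtain ⟨C, hC, hbound⟩ := exists_norm_sq_averagedSum_le
  obtain ⟨C', hC', hsum⟩ := exists_sum_rpow_le_gaussRate_rpow hp
  set r := p / 2 with hr
  have hr1 : 1 < r := by linarith
  have hr0 : 0 < r - 1 := by linarith
  set K := C ^ r * (2 ^ r * (1 + 2 / (r - 1) * C')) with hK
  have hK0 : 0 < K := by positivity
  refine ⟨K ^ (1 / p), by positivity, fun P N hN => ?_⟩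
  have hN0 : 0 < N := by omega
  have hN' : (0 : ℝ) < N := by exact_mod_cast hN0
  refine torusNorm_le_of_integral_le (by linarith)
    (mul_nonneg (by positivity) (gaussRate_nonneg p N)) (continuous_averagedSum _ _ _) ?_
  rw [Real.mul_rpow (by positivity) (gaussRate_nonneg p N), ← Real.rpow_mul hK0.le,
    one_div_mul_cancel (by linarith), Real.rpow_one]
  -- The q found above depends on x; summing over all q ≤ 4N removes the dependence.
  have hpt : ∀ x, ‖averagedSum P (N / 8) (N - N / 8) x‖ ^ p ≤ C ^ r * (2 ^ r * ((N : ℝ) ^ r +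
      ∑ q ∈ Finset.Icc 1 (4 * N), ((N : ℝ) ^ 2 / (q + N ^ 2 * ‖(q * 2) • x‖)) ^ r)) := by
    intro x
    obtain ⟨q, hq, hle⟩ := hbound P N x hN
    calc ‖averagedSum P (N / 8) (N - N / 8) x‖ ^ p
        = (‖averagedSum P (N / 8) (N - N / 8) x‖ ^ 2) ^ r := by
          rw [← Real.rpow_natCast, ← Real.rpow_mul (norm_nonneg _)]; congr 1; rw [hr]; push_cast; ring
      _ ≤ (C * (N + N ^ 2 / (q + N ^ 2 * ‖(q * 2) • x‖))) ^ r := by gcongr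
      _ = C ^ r * (N + N ^ 2 / (q + N ^ 2 * ‖(q * 2) • x‖)) ^ r :=
          Real.mul_rpow hC.le (by positivity)
      _ ≤ C ^ r * (2 ^ r * ((N : ℝ) ^ r + (N ^ 2 / (q + N ^ 2 * ‖(q * 2) • x‖)) ^ r)) := by
          gcongr
          exact add_rpow_le_two_rpow_mul (by positivity) (by positivity) (by linarith)
      _ ≤ _ := by
          gcongr
          exact Finset.single_le_sum
            (f := fun q : ℕ => ((N : ℝ) ^ 2 / (q + N ^ 2 * ‖(q * 2) • x‖)) ^ r)
            (fun _ _ => by positivity) hq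
  have hcq : ∀ q ∈ Finset.Icc 1 (4 * N), Continuous fun x : UnitAddCircle =>
      ((N : ℝ) ^ 2 / (q + N ^ 2 * ‖(q * 2) • x‖)) ^ r := fun q hq =>
    continuous_div_add_mul_norm_rpow (Finset.mem_Icc.1 hq).1 (by linarith)
  have hcs := continuous_finsetSum _ hcq
  have hNr : (N : ℝ) ^ r ≤ gaussRate p N ^ p := by
    calc (N : ℝ) ^ r = ((N : ℝ) ^ (1 / 2 : ℝ)) ^ p := by
          rw [← Real.rpow_mul hN'.le]; congr 1; rw [hr]; ring
      _ ≤ _ := by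
          gcongr
          exact rpow_half_le_gaussRate p hN0
  calc ∫ x, ‖averagedSum P (N / 8) (N - N / 8) x‖ ^ p
      ≤ ∫ x : UnitAddCircle, C ^ r * (2 ^ r * ((N : ℝ) ^ r +
        ∑ q ∈ Finset.Icc 1 (4 * N), ((N : ℝ) ^ 2 / (q + N ^ 2 * ‖(q * 2) • x‖)) ^ r)) := by
        refine integral_mono ?_ ?_ hpt
        · exact ((continuous_averagedSum _ _ _).norm.rpow_const
            fun _ => Or.inr (by linarith)).integrable_unitAddCircle
        · exact (continuous_const.mul (continuous_const.mul
            (continuous_const.add hcs))).integrable_unitAddCircle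
    _ = C ^ r * (2 ^ r * ((N : ℝ) ^ r + ∑ q ∈ Finset.Icc 1 (4 * N),
        ∫ x : UnitAddCircle, ((N : ℝ) ^ 2 / (q + N ^ 2 * ‖(q * 2) • x‖)) ^ r)) := by
        rw [integral_const_mul, integral_const_mul, integral_add (integrable_const _)
          hcs.integrable_unitAddCircle, integral_finsetSum _
          fun q hq => (hcq q hq).integrable_unitAddCircle]
        simp
    _ ≤ C ^ r * (2 ^ r * ((N : ℝ) ^ r + ∑ q ∈ Finset.Icc 1 (4 * N),
        2 / (r - 1) * ((N : ℝ) ^ 2 / q) ^ (r - 1))) := by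
        gcongr with q hq
        exact integral_div_add_mul_norm_rpow_le hN0 (Finset.mem_Icc.1 hq).1 hr1
    _ ≤ C ^ r * (2 ^ r * (gaussRate p N ^ p + 2 / (r - 1) * (C' * gaussRate p N ^ p))) := by
        rw [← Finset.mul_sum]
        gcongr
        exact hsum N hN0
    _ = K * gaussRate p N ^ p := by rw [hK]; ring

/-! ### Upper bounds for sums with monotone weights -/

/-- `∑_{i < N} w_i e^{2πi (P + i)² x}`. -/
noncomputable def weightedSum (w : ℕ → ℝ) (P N : ℕ) (x : UnitAddCircle) : ℂ :=
  ∑ i ∈ Finset.range N, (w i : ℂ) * fourier (((P + i : ℕ) : ℤ) ^ 2) x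

theorem continuous_weightedSum (w : ℕ → ℝ) (P N : ℕ) : Continuous (weightedSum w P N) :=
  continuous_finsetSum _ fun _ _ => continuous_const.mul (continuous_fourier _)

/-- `∑_{i < N} e^{2πi (P + i)² x}`. -/
noncomputable def shiftedSum (P N : ℕ) (x : UnitAddCircle) : ℂ :=
  ∑ i ∈ Finset.range N, fourier (((P + i : ℕ) : ℤ) ^ 2) x

theorem continuous_shiftedSum (P N : ℕ) : Continuous (shiftedSum P N) :=
  continuous_finsetSum _ fun _ _ => continuous_fourier _

theorem shiftedSum_add (P M N : ℕ) (x : UnitAddCircle) :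
    shiftedSum P (M + N) x = shiftedSum P M x + shiftedSum (P + M) N x := by
  simp only [shiftedSum, Finset.sum_range_add, add_assoc]

theorem torusNorm_shiftedSum_le {p : ℝ} (hp : 1 ≤ p) (P N : ℕ) :
    torusNorm p (shiftedSum P N) ≤ N := by
  refine (torusNorm_sum_le hp _ fun i _ => continuous_fourier _).trans ?_
  simp [torusNorm_fourier (by linarith : 0 < p), -fourier_apply]

/-- For each j < L the window of length M + L splits into an initial piece of length j, the shifted
window of length M, and a final piece of length L - j; the identity is the mean over j. -/
theorem shiftedSum_eq_averagedSum_add {L : ℕ} (hL : 0 < L) (P M : ℕ) (x : UnitAddCircle) :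
    shiftedSum P (M + L) x = averagedSum P L M x + (L : ℂ)⁻¹ * ∑ j ∈ Finset.range L,
      (shiftedSum P j x + shiftedSum (P + j + M) (L - j) x) := by
  have hL' : (L : ℂ) ≠ 0 := by exact_mod_cast hL.ne'
  have h : ∀ j ∈ Finset.range L, shiftedSum P (M + L) x
      = shiftedSum (P + j) M x + (shiftedSum P j x + shiftedSum (P + j + M) (L - j) x) := by
    intro j hj
    rw [Finset.mem_range] at hj
    rw [show M + L = j + (M + (L - j)) by omega, shiftedSum_add, shiftedSum_add]
    ring
  have hs := Finset.sum_congr rfl h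
  rw [Finset.sum_const, Finset.card_range, nsmul_eq_mul, Finset.sum_add_distrib] at hs
  rw [averagedSum, ← mul_add, eq_inv_mul_iff_mul_eq₀ hL', hs]
  rfl

theorem exists_torusNorm_shiftedSum_le {p : ℝ} (hp : 3 ≤ p) :
    ∃ C : ℝ, 0 < C ∧ ∀ P N : ℕ, torusNorm p (shiftedSum P N) ≤ C * gaussRate p N := by
  obtain ⟨C, hC, hA⟩ := exists_torusNorm_averagedSum_le hp
  have hp1 : 1 ≤ p := by linarith
  -- The constant K must satisfy C + (3/4)K ≤ K for the recursion and K ≥ 8 for the trivial bound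
  -- when N < 8.
  refine ⟨4 * C + 8, by positivity, fun P N => ?_⟩
  induction N using Nat.strong_induction_on generalizing P with
  | _ N ih =>
  rcases Nat.eq_zero_or_pos N with rfl | hN
  · refine (torusNorm_shiftedSum_le hp1 P 0).trans ?_
    have := gaussRate_nonneg p 0
    push_cast; positivity
  have hG1 : 1 ≤ gaussRate p N := by
    refine le_trans ?_ (rpow_half_le_gaussRate p hN)
    exact Real.one_le_rpow (by exact_mod_cast hN) (by norm_num)
  rcases lt_or_ge N 8 with h8 | h8
  · refine (torusNorm_shiftedSum_le hp1 P N).trans ?_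
    have : (N : ℝ) ≤ 8 := by exact_mod_cast h8.le
    nlinarith
  set L := N / 8 with hL
  have hL0 : 0 < L := by omega
  have hL' : (0 : ℝ) < L := by exact_mod_cast hL0
  have hdecomp : shiftedSum P N = fun x => averagedSum P L (N - L) x + (L : ℂ)⁻¹ *
      ∑ j ∈ Finset.range L, (shiftedSum P j x + shiftedSum (P + j + (N - L)) (L - j) x) := by
    funext x
    rw [← shiftedSum_eq_averagedSum_add hL0, show N - L + L = N by omega]
  have hcont : ∀ j ∈ Finset.range L, Continuous fun x =>
      shiftedSum P j x + shiftedSum (P + j + (N - L)) (L - j) x := fun j _ =>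
    (continuous_shiftedSum _ _).add (continuous_shiftedSum _ _)
  have hsmall : ∀ Q i, i ≤ L → torusNorm p (shiftedSum Q i)
      ≤ (4 * C + 8) * (3 / 8 * gaussRate p N) := by
    intro Q i hi
    refine (ih i (by omega) Q).trans ?_
    gcongr
    exact gaussRate_le_of_eight_mul_le (by omega)
  rw [hdecomp]
  calc _ ≤ torusNorm p (averagedSum P L (N - L)) + torusNorm p (fun x => (L : ℂ)⁻¹ *
        ∑ j ∈ Finset.range L, (shiftedSum P j x + shiftedSum (P + j + (N - L)) (L - j) x)) :=
        torusNorm_add_le hp1 (continuous_averagedSum _ _ _)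
          (continuous_const.mul (continuous_finsetSum _ hcont))
    _ ≤ C * gaussRate p N + (L : ℝ)⁻¹ * ∑ j ∈ Finset.range L,
          ((4 * C + 8) * (3 / 8 * gaussRate p N) + (4 * C + 8) * (3 / 8 * gaussRate p N)) := by
        rw [torusNorm_const_mul, norm_inv, Complex.norm_natCast]
        gcongr
        · exact hA P N h8
        · refine (torusNorm_sum_le hp1 _ hcont).trans (Finset.sum_le_sum fun j hj => ?_)
          rw [Finset.mem_range] at hj
          exact (torusNorm_add_le hp1 (continuous_shiftedSum _ _) (continuous_shiftedSum _ _)).trans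
            (add_le_add (hsmall _ _ hj.le) (hsmall _ _ (by omega)))
    _ = (C + 3 / 4 * (4 * C + 8)) * gaussRate p N := by
        rw [Finset.sum_const, Finset.card_range, nsmul_eq_mul]; field_simp; ring
    _ ≤ _ := mul_le_mul_of_nonneg_right (by linarith) (gaussRate_nonneg p N)

theorem weightedSum_eq_summation_by_parts (w : ℕ → ℝ) (P N : ℕ) (x : UnitAddCircle) :
    weightedSum w P N x = (w (N - 1) : ℂ) * shiftedSum P N x
      + ∑ i ∈ Finset.range (N - 1), ((w i - w (i + 1) : ℝ) : ℂ) * shiftedSum P (i + 1) x := by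
  have h := Finset.sum_range_by_parts (fun i => (w i : ℂ))
    (fun i => fourier (((P + i : ℕ) : ℤ) ^ 2) x) N
  simp only [smul_eq_mul] at h
  rw [weightedSum, h, sub_eq_add_neg, ← Finset.sum_neg_distrib]
  congr 1
  refine Finset.sum_congr rfl fun i _ => ?_
  rw [shiftedSum]; push_cast; ring

theorem sum_abs_sub_le_of_monotone_or_antitone {w : ℕ → ℝ} (hw : Monotone w ∨ Antitone w)
    {W : ℝ} {n : ℕ} (h0 : 0 ≤ w 0) (hn : 0 ≤ w n) (h0W : w 0 ≤ W) (hnW : w n ≤ W) :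
    ∑ i ∈ Finset.range n, |w i - w (i + 1)| ≤ W := by
  rcases hw with hw | hw
  · have : ∀ i ∈ Finset.range n, |w i - w (i + 1)| = w (i + 1) - w i := fun i _ => by
      rw [abs_sub_comm, abs_of_nonneg (sub_nonneg.2 (hw (Nat.le_succ i)))]
    rw [Finset.sum_congr rfl this, Finset.sum_range_sub]
    linarith
  · have : ∀ i ∈ Finset.range n, |w i - w (i + 1)| = w i - w (i + 1) := fun i _ =>
      abs_of_nonneg (sub_nonneg.2 (hw (Nat.le_succ i)))
    rw [Finset.sum_congr rfl this, Finset.sum_range_sub']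
    linarith

theorem exists_torusNorm_weightedSum_le_of_three_le {p : ℝ} (hp : 3 ≤ p) :
    ∃ C : ℝ, 0 < C ∧ ∀ (w : ℕ → ℝ) (W : ℝ) (P N : ℕ), 0 < N → (Monotone w ∨ Antitone w) →
      (∀ i < N, 0 ≤ w i ∧ w i ≤ W) →
      torusNorm p (weightedSum w P N) ≤ C * (W * gaussRate p N) := by
  obtain ⟨C, hC, hS⟩ := exists_torusNorm_shiftedSum_le hp
  have hp1 : 1 ≤ p := by linarith
  refine ⟨2 * C, by positivity, fun w W P N hN hmono hw => ?_⟩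
  obtain ⟨h0, h0W⟩ := hw 0 hN
  obtain ⟨hn, hnW⟩ := hw (N - 1) (by omega)
  have hG := gaussRate_nonneg p N
  have hcont : ∀ i ∈ Finset.range (N - 1), Continuous fun x =>
      ((w i - w (i + 1) : ℝ) : ℂ) * shiftedSum P (i + 1) x := fun i _ =>
    continuous_const.mul (continuous_shiftedSum _ _)
  have heq : weightedSum w P N = fun x => (w (N - 1) : ℂ) * shiftedSum P N x
      + ∑ i ∈ Finset.range (N - 1), ((w i - w (i + 1) : ℝ) : ℂ) * shiftedSum P (i + 1) x :=
    funext fun x => weightedSum_eq_summation_by_parts w P N x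
  rw [heq]
  refine (torusNorm_add_le hp1 (continuous_const.mul (continuous_shiftedSum _ _))
    (continuous_finsetSum _ hcont)).trans ?_
  have h1 : torusNorm p (fun x => (w (N - 1) : ℂ) * shiftedSum P N x)
      ≤ W * (C * gaussRate p N) := by
    rw [torusNorm_const_mul, Complex.norm_real, Real.norm_of_nonneg hn]
    exact mul_le_mul hnW (hS P N) (torusNorm_nonneg _ _) (h0.trans h0W)
  have h2 : torusNorm p (fun x => ∑ i ∈ Finset.range (N - 1),
      ((w i - w (i + 1) : ℝ) : ℂ) * shiftedSum P (i + 1) x) ≤ W * (C * gaussRate p N) := by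
    calc _ ≤ ∑ i ∈ Finset.range (N - 1), |w i - w (i + 1)| * (C * gaussRate p N) := by
          refine (torusNorm_sum_le hp1 _ hcont).trans (Finset.sum_le_sum fun i hi => ?_)
          rw [Finset.mem_range] at hi
          rw [torusNorm_const_mul, Complex.norm_real, Real.norm_eq_abs]
          gcongr
          exact (hS P (i + 1)).trans (by gcongr; exact gaussRate_mono (by omega))
      _ ≤ _ := by
          rw [← Finset.sum_mul]
          gcongr
          exact sum_abs_sub_le_of_monotone_or_antitone hmono h0 hn h0W hnW
  exact (add_le_add h1 h2).trans_eq (by ring)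

theorem exists_torusNorm_weightedSum_le (p : ℝ) :
    ∃ C : ℝ, 0 < C ∧ ∀ (w : ℕ → ℝ) (W : ℝ) (P N : ℕ), 0 < N → (Monotone w ∨ Antitone w) →
      (∀ i < N, 0 ≤ w i ∧ w i ≤ W) →
      torusNorm p (weightedSum w P N) ≤ C * (W * gaussRate p N) := by
  rcases le_total 3 p with hp | hp
  · exact exists_torusNorm_weightedSum_le_of_three_le hp
  -- Norms increase with the exponent on a probability space, and nothing is lost in passing to p =
  -- 3 because `gaussRate` is constant in p below 4.
  · obtain ⟨C, hC, h⟩ := exists_torusNorm_weightedSum_le_of_three_le le_rfl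
    refine ⟨C, hC, fun w W P N hN hmono hw =>
      (torusNorm_mono_exponent hp (continuous_weightedSum _ _ _)).trans ?_⟩
    have := h w W P N hN hmono hw
    rw [gaussRate, if_pos (by norm_num)] at this
    rwa [gaussRate, if_pos (by linarith)]

/-! ### Lower bounds -/

theorem integral_norm_sq_sum_fourier {ι : Type*} (T : Finset ι) (c : ι → ℝ) (l : ι → ℤ) :
    ∫ x : UnitAddCircle, ‖∑ k ∈ T, (c k : ℂ) * fourier (l k) x‖ ^ 2
      = ∑ k ∈ T, ∑ k' ∈ T, if l k = l k' then c k * c k' else 0 := by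
  have hexp : ∀ x : UnitAddCircle, ((‖∑ k ∈ T, (c k : ℂ) * fourier (l k) x‖ ^ 2 : ℝ) : ℂ)
      = ∑ k ∈ T, ∑ k' ∈ T, ((c k * c k' : ℝ) : ℂ) * fourier (l k - l k') x := by
    intro x
    rw [← Complex.normSq_eq_norm_sq, ← Complex.mul_conj, map_sum, Finset.sum_mul_sum]
    refine Finset.sum_congr rfl fun k _ => Finset.sum_congr rfl fun k' _ => ?_
    rw [map_mul, Complex.conj_ofReal, ← fourier_neg, mul_mul_mul_comm, ← fourier_add,
      ← sub_eq_add_neg, Complex.ofReal_mul]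
  have hc : ∀ k k', Continuous fun x : UnitAddCircle =>
      ((c k * c k' : ℝ) : ℂ) * fourier (l k - l k') x := fun _ _ =>
    continuous_const.mul (continuous_fourier _)
  rw [← Complex.ofReal_inj, ← integral_complex_ofReal]
  simp only [hexp]
  rw [integral_finsetSum _ fun k _ => (continuous_finsetSum _
    fun k' _ => hc k k').integrable_unitAddCircle_complex]
  push_cast
  refine Finset.sum_congr rfl fun k _ => ?_
  rw [integral_finsetSum _ fun k' _ => by
    simpa using (hc k k').integrable_unitAddCircle_complex]
  refine Finset.sum_congr rfl fun k' _ => ?_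
  rw [integral_const_mul, integral_fourier]
  simp only [sub_eq_zero]
  split_ifs <;> simp

/-- The coefficients are nonnegative, so every coincidence of frequencies contributes at least v².
Applied to the sum it gives the L² bound, applied to its square the L⁴ bound. -/
theorem sq_mul_card_le_integral_norm_sq_sum_fourier {ι : Type*} (T : Finset ι) {c : ι → ℝ}
    (l : ι → ℤ) {v : ℝ} (hv : 0 ≤ v) (hc : ∀ k ∈ T, v ≤ c k) :
    v ^ 2 * ((T ×ˢ T).filter fun kk => l kk.1 = l kk.2).card
      ≤ ∫ x : UnitAddCircle, ‖∑ k ∈ T, (c k : ℂ) * fourier (l k) x‖ ^ 2 := by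
  rw [integral_norm_sq_sum_fourier, ← Finset.sum_product', ← Finset.sum_filter, mul_comm,
    ← nsmul_eq_mul]
  refine Finset.card_nsmul_le_sum _ _ _ fun kk hkk => ?_
  rw [Finset.mem_filter, Finset.mem_product] at hkk
  rw [sq]
  exact mul_le_mul (hc _ hkk.1.1) (hc _ hkk.1.2) hv (hv.trans (hc _ hkk.1.1))

theorem sq_mul_le_integral_norm_sq_weightedSum {w : ℕ → ℝ} {v : ℝ} (P N : ℕ) (hv : 0 ≤ v)
    (hw : ∀ i < N, v ≤ w i) : v ^ 2 * N ≤ ∫ x, ‖weightedSum w P N x‖ ^ 2 := by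
  refine le_trans ?_ (sq_mul_card_le_integral_norm_sq_sum_fourier (Finset.range N)
    (fun i => (((P + i : ℕ) : ℤ)) ^ 2) hv fun i hi => hw i (Finset.mem_range.1 hi))
  have : N ≤ (((Finset.range N) ×ˢ (Finset.range N)).filter fun kk =>
      (((P + kk.1 : ℕ) : ℤ)) ^ 2 = (((P + kk.2 : ℕ) : ℤ)) ^ 2).card := by
    rw [← Finset.card_range N]
    refine Finset.card_le_card_of_injOn (fun i => (i, i)) ?_ ?_
    · intro i hi; simpa using hi
    · intro i _ j _ h; exact (Prod.mk.inj h).1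
  gcongr

/-- The first term dominates where t ≥ 1/ε, the second where t ≤ 1/ε. -/
theorem sq_le_mul_rpow_three_add {t ε p : ℝ} (ht : 0 ≤ t) (hε : 0 < ε) (hp : 0 < p) (hp2 : p ≤ 2) :
    t ^ (2 : ℝ) ≤ ε * t ^ (3 : ℝ) + (ε⁻¹) ^ (2 - p) * t ^ p := by
  rcases ht.eq_or_lt with rfl | ht'
  · rw [Real.zero_rpow hp.ne', Real.zero_rpow two_ne_zero, Real.zero_rpow three_ne_zero]; simp
  rcases le_total t ε⁻¹ with h | h
  · have h1 : t ^ (2 : ℝ) = t ^ (2 - p) * t ^ p := by rw [← Real.rpow_add ht']; congr 1; ring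
    have h2 : t ^ (2 - p) * t ^ p ≤ (ε⁻¹) ^ (2 - p) * t ^ p := by gcongr
    have h3 : 0 ≤ ε * t ^ (3 : ℝ) := by positivity
    linarith
  · have h1 : t ^ (3 : ℝ) = t * t ^ (2 : ℝ) := by
      rw [← Real.rpow_one_add' ht (by norm_num)]; congr 1; norm_num
    have h2 : 1 ≤ ε * t := by rwa [inv_le_iff_one_le_mul₀' hε] at h
    have h3 : 0 ≤ (ε⁻¹) ^ (2 - p) * t ^ p := by positivity
    have h4 : 1 * t ^ (2 : ℝ) ≤ ε * t * t ^ (2 : ℝ) := by gcongr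
    rw [h1]; linarith

theorem exists_mul_le_torusNorm_of_integral_sq_of_torusNorm_three {p : ℝ} (hp : 0 < p) {D : ℝ}
    (hD : 0 < D) : ∃ c : ℝ, 0 < c ∧ ∀ (f : UnitAddCircle → ℂ) (σ : ℝ), Continuous f → 0 < σ →
      σ ^ 2 ≤ ∫ x, ‖f x‖ ^ 2 → torusNorm 3 f ≤ D * σ → c * σ ≤ torusNorm p f := by
  rcases le_total 2 p with hp2 | hp2
  · refine ⟨1, one_pos, fun f σ hf hσ h2 _ => ?_⟩
    refine le_trans ?_ (torusNorm_mono_exponent hp2 hf)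
    refine le_torusNorm_of_le_integral two_pos (by positivity) hf ?_
    simpa using h2
  refine ⟨((2 * D ^ 3) ^ (p - 2) / 2) ^ (1 / p), by positivity, fun f σ hf hσ h2 h3 => ?_⟩
  refine le_torusNorm_of_le_integral hp (by positivity) hf ?_
  rw [Real.mul_rpow (by positivity) hσ.le, ← Real.rpow_mul (by positivity),
    one_div_mul_cancel hp.ne', Real.rpow_one]
  have h3' : ∫ x, ‖f x‖ ^ (3 : ℝ) ≤ D ^ 3 * σ ^ 3 := by
    rw [← torusNorm_rpow three_pos hf, ← mul_pow, ← Real.rpow_natCast]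
    exact Real.rpow_le_rpow (torusNorm_nonneg _ _) h3 (by norm_num)
  -- With this ε the cubic term is at most σ²/2, half of the L² mass, and the rest falls on the p-th
  -- power.
  set ε := (2 * D ^ 3 * σ)⁻¹ with hε
  have hε0 : 0 < ε := by positivity
  have hint : ∀ r : ℝ, 0 < r → Integrable fun x => ‖f x‖ ^ r := fun r hr =>
    (hf.norm.rpow_const fun _ => Or.inr hr.le).integrable_unitAddCircle
  have hmain : ∫ x, ‖f x‖ ^ 2 ≤ ε * (∫ x, ‖f x‖ ^ (3 : ℝ)) + (ε⁻¹) ^ (2 - p) * ∫ x, ‖f x‖ ^ p := by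
    rw [← integral_const_mul, ← integral_const_mul, ← integral_add
      ((hint 3 three_pos).const_mul _) ((hint p hp).const_mul _)]
    refine integral_mono (hf.norm.pow 2).integrable_unitAddCircle
      (((hint 3 three_pos).const_mul _).add ((hint p hp).const_mul _)) fun x => ?_
    simpa using sq_le_mul_rpow_three_add (norm_nonneg (f x)) hε0 hp hp2
  have h4 : ε * ∫ x, ‖f x‖ ^ (3 : ℝ) ≤ σ ^ 2 / 2 := by
    calc _ ≤ ε * (D ^ 3 * σ ^ 3) := by gcongr
      _ = σ ^ 2 / 2 := by rw [hε]; field_simp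
  have h5 : σ ^ 2 / 2 ≤ (2 * D ^ 3 * σ) ^ (2 - p) * ∫ x, ‖f x‖ ^ p := by
    have h6 : ε⁻¹ = 2 * D ^ 3 * σ := by rw [hε, inv_inv]
    rw [h6] at hmain
    linarith
  have h6 : (2 * D ^ 3 * σ) ^ (2 - p) = ((2 * D ^ 3 * σ) ^ (p - 2))⁻¹ := by
    rw [← Real.rpow_neg (by positivity)]; congr 1; ring
  rw [h6, le_inv_mul_iff₀ (by positivity), Real.mul_rpow (by positivity) hσ.le] at h5
  refine le_trans (le_of_eq ?_) h5
  have : σ ^ p = σ ^ (p - 2) * σ ^ 2 := by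
    rw [← Real.rpow_natCast σ 2, ← Real.rpow_add hσ]; congr 1; push_cast; ring
  rw [this]; ring

/-- Every phase satisfies |n²t| ≤ 1/6, so its angle is at most π/3 and its cosine at least 1/2. -/
theorem half_mul_le_norm_weightedSum {w : ℕ → ℝ} {v : ℝ} {P N : ℕ} (hv : 0 ≤ v)
    (hw : ∀ i < N, v ≤ w i) {x : UnitAddCircle} (hx : 6 * (P + N : ℝ) ^ 2 * ‖x‖ ≤ 1) :
    v * N / 2 ≤ ‖weightedSum w P N x‖ := by
  obtain ⟨t, ht, habs, -⟩ := x.exists_coe_eq_abs_eq_norm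
  rw [← habs] at hx
  refine le_trans ?_ (Complex.re_le_norm _)
  rw [weightedSum, Complex.re_sum]
  have hterm : ∀ i ∈ Finset.range N,
      v / 2 ≤ ((w i : ℂ) * fourier (((P + i : ℕ) : ℤ) ^ 2) x).re := by
    intro i hi
    rw [Finset.mem_range] at hi
    have hi' : (i : ℝ) ≤ N := by exact_mod_cast hi.le
    set n : ℤ := ((P + i : ℕ) : ℤ) ^ 2 with hn
    have hcoe : ((n * t : ℝ) : UnitAddCircle) = n • x := by
      rw [← ht, ← AddCircle.coe_zsmul, zsmul_eq_mul]
    have hn1 : |(n : ℝ) * t| ≤ 1 / 6 := by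
      have h0 : (n : ℝ) = ((P : ℝ) + i) ^ 2 := by rw [hn]; push_cast; ring
      rw [h0, abs_mul, abs_of_nonneg (by positivity)]
      have : ((P : ℝ) + i) ^ 2 * |t| ≤ (P + N : ℝ) ^ 2 * |t| := by gcongr
      linarith
    have hcos : 1 / 2 ≤ Real.cos (2 * Real.pi * (n * t)) := by
      rw [← Real.cos_pi_div_three, ← Real.cos_abs (2 * Real.pi * (n * t))]
      have hpi := Real.pi_pos
      apply Real.cos_le_cos_of_nonneg_of_le_pi (abs_nonneg _) (by linarith)
      rw [abs_mul, abs_of_pos (by positivity)]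
      nlinarith
    rw [Complex.re_ofReal_mul, fourier_eq_exp_two_pi_mul hcoe, mul_comm Complex.I,
      Complex.exp_ofReal_mul_I_re]
    have := hw i hi
    nlinarith
  have := Finset.card_nsmul_le_sum _ _ _ hterm
  rw [Finset.card_range, nsmul_eq_mul] at this
  linarith

theorem exists_mul_rpow_le_torusNorm_weightedSum {p : ℝ} (hp : 0 < p) :
    ∃ c : ℝ, 0 < c ∧ ∀ (w : ℕ → ℝ) (v : ℝ) (P N : ℕ), 0 < N → P ≤ N → 0 ≤ v →
      (∀ i < N, v ≤ w i) → c * (v * (N : ℝ) ^ (1 - 2 / p)) ≤ torusNorm p (weightedSum w P N) := by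
  refine ⟨1 / 2 * (1 / 12) ^ (1 / p), by positivity, fun w v P N hN hPN hv hw => ?_⟩
  have hN' : (0 : ℝ) < N := by exact_mod_cast hN
  have hPN' : (P : ℝ) ≤ N := by exact_mod_cast hPN
  have hf := continuous_weightedSum w P N
  refine le_torusNorm_of_le_integral hp (by positivity) hf ?_
  -- P ≤ N bounds the frequencies by (2N)², and 6 (2N)² ρ = 1.
  set ρ : ℝ := 1 / (24 * N ^ 2) with hρ
  have hρ0 : 0 < ρ := by positivity
  have hN1 : (1 : ℝ) ≤ N := by exact_mod_cast hN
  have hρ1 : 2 * ρ ≤ 1 := by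
    rw [hρ, mul_one_div, div_le_one (by positivity)]; nlinarith
  have hvol : (volume : Measure UnitAddCircle).real (Metric.closedBall 0 ρ) = 2 * ρ := by
    rw [measureReal_def, AddCircle.volume_closedBall, min_eq_right hρ1,
      ENNReal.toReal_ofReal (by positivity)]
  have hball : ∀ x ∈ Metric.closedBall (0 : UnitAddCircle) ρ,
      (v * N / 2) ^ p ≤ ‖weightedSum w P N x‖ ^ p := by
    intro x hx
    rw [mem_closedBall_zero_iff] at hx
    gcongr
    refine half_mul_le_norm_weightedSum hv hw ?_
    calc 6 * (P + N : ℝ) ^ 2 * ‖x‖ ≤ 6 * (N + N : ℝ) ^ 2 * ρ := by gcongr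
      _ = 1 := by rw [hρ]; field_simp; norm_num
  have hint : Integrable fun x => ‖weightedSum w P N x‖ ^ p :=
    (hf.norm.rpow_const fun _ => Or.inr hp.le).integrable_unitAddCircle
  calc (1 / 2 * (1 / 12) ^ (1 / p) * (v * (N : ℝ) ^ (1 - 2 / p))) ^ p
      = (v * N / 2) ^ p * (2 * ρ) := by
        rw [show 1 / 2 * (1 / 12) ^ (1 / p) * (v * (N : ℝ) ^ (1 - 2 / p))
          = (v * N / 2) * ((1 / 12 : ℝ) ^ (1 / p) * (N : ℝ) ^ (-2 / p)) by
            rw [show 1 - 2 / p = 1 + -2 / p by ring, Real.rpow_add hN', Real.rpow_one]; ring,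
          Real.mul_rpow (by positivity) (by positivity), Real.mul_rpow (by positivity)
          (by positivity), ← Real.rpow_mul (by positivity), ← Real.rpow_mul hN'.le,
          one_div_mul_cancel hp.ne', div_mul_cancel₀ _ hp.ne', Real.rpow_one,
          Real.rpow_neg hN'.le, Real.rpow_two, hρ]
        congr 1; field_simp; norm_num
    _ = ∫ _ in Metric.closedBall (0 : UnitAddCircle) ρ, (v * N / 2) ^ p := by
        rw [setIntegral_const, hvol, smul_eq_mul, mul_comm]
    _ ≤ ∫ x in Metric.closedBall (0 : UnitAddCircle) ρ, ‖weightedSum w P N x‖ ^ p :=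
        setIntegral_mono_on (integrable_const _) hint.integrableOn
          Metric.isClosed_closedBall.measurableSet hball
    _ ≤ _ := setIntegral_le_integral hint (Filter.Eventually.of_forall fun x => by positivity)

/-! ### Counting solutions of `n₁² + n₂² = n₃² + n₄²` -/

/-- From ∑_{d ∣ m} φ(d) = m one gets 1/m = ∑_{de = m} (φ(d)/d²)(1/e²). Summing over m ≤ X bounds the
harmonic sum by ∑ φ(d)/d² times the convergent ∑ 1/e². -/
theorem exists_mul_log_le_sum_totient_div_sq :
    ∃ c : ℝ, 0 < c ∧ ∀ X : ℕ, c * Real.log (X + 1)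
      ≤ ∑ b ∈ Finset.Icc 1 X, (b.totient : ℝ) / b ^ 2 := by
  have hs : Summable fun e : ℕ => 1 / (e : ℝ) ^ 2 := Real.summable_one_div_nat_pow.2 one_lt_two
  set S := ∑' e : ℕ, 1 / (e : ℝ) ^ 2 with hS
  have hS0 : 0 < S := hs.tsum_pos (fun _ => by positivity) 1 (by norm_num)
  refine ⟨S⁻¹, by positivity, fun X => ?_⟩
  rw [inv_mul_le_iff₀ hS0]
  have hlog := log_add_one_le_harmonic X
  rw [harmonic_eq_sum_Icc] at hlog
  push_cast at hlog
  refine hlog.trans ?_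
  have hterm : ∀ m ∈ Finset.Icc 1 X, ((m : ℝ))⁻¹
      = ∑ de ∈ m.divisorsAntidiagonal, (de.1.totient : ℝ) / de.1 ^ 2 * (1 / (de.2 : ℝ) ^ 2) := by
    intro m hm
    have hm0 : (m : ℝ) ≠ 0 := by
      have := (Finset.mem_Icc.1 hm).1
      exact_mod_cast (by omega : m ≠ 0)
    have h1 : ∀ de ∈ m.divisorsAntidiagonal,
        (de.1.totient : ℝ) / de.1 ^ 2 * (1 / (de.2 : ℝ) ^ 2) = de.1.totient / (m : ℝ) ^ 2 := by
      intro de hde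
      rw [← (Nat.mem_divisorsAntidiagonal.1 hde).1]
      push_cast; rw [mul_pow, div_mul_div_comm, mul_one]
    rw [Finset.sum_congr rfl h1, ← Finset.sum_div, Nat.sum_divisorsAntidiagonal
      (fun d _ => (d.totient : ℝ)), ← Nat.cast_sum, Nat.sum_totient]
    field_simp
  rw [Finset.sum_congr rfl hterm, Finset.sum_sigma']
  have hinj : Set.InjOn (fun σ : Σ _ : ℕ, ℕ × ℕ => σ.2)
      ((Finset.Icc 1 X).sigma fun m => m.divisorsAntidiagonal : Finset (Σ _ : ℕ, ℕ × ℕ)) := by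
    rintro ⟨m, de⟩ hm ⟨m', de'⟩ hm' h
    simp only [Finset.coe_sigma, Set.mem_sigma_iff, Finset.mem_coe,
      Nat.mem_divisorsAntidiagonal] at hm hm' h
    subst h
    rw [← hm.2.1, ← hm'.2.1]
  rw [← Finset.sum_image (f := fun de : ℕ × ℕ =>
    (de.1.totient : ℝ) / de.1 ^ 2 * (1 / (de.2 : ℝ) ^ 2)) hinj]
  calc _ ≤ ∑ de ∈ Finset.Icc 1 X ×ˢ Finset.Icc 1 X,
        (de.1.totient : ℝ) / de.1 ^ 2 * (1 / (de.2 : ℝ) ^ 2) := by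
        refine Finset.sum_le_sum_of_subset_of_nonneg ?_ fun _ _ _ => by positivity
        intro de hde
        obtain ⟨⟨m, de'⟩, hm, rfl⟩ := Finset.mem_image.1 hde
        rw [Finset.mem_sigma, Finset.mem_Icc, Nat.mem_divisorsAntidiagonal] at hm
        obtain ⟨⟨-, hmX⟩, hprod, hne⟩ := hm
        simp only at hprod hne hmX
        have h1 : de'.1 ≠ 0 := fun h => hne (by rw [← hprod, h, zero_mul])
        have h2 : de'.2 ≠ 0 := fun h => hne (by rw [← hprod, h, mul_zero])
        have h3 : de'.1 ≤ m := hprod ▸ Nat.le_mul_of_pos_right _ (Nat.pos_of_ne_zero h2)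
        have h4 : de'.2 ≤ m := hprod ▸ Nat.le_mul_of_pos_left _ (Nat.pos_of_ne_zero h1)
        simp only [Finset.mem_product, Finset.mem_Icc]
        omega
    _ = (∑ b ∈ Finset.Icc 1 X, (b.totient : ℝ) / b ^ 2) *
          ∑ e ∈ Finset.Icc 1 X, 1 / (e : ℝ) ^ 2 := by
        rw [Finset.sum_product, Finset.sum_mul_sum]
    _ ≤ _ := by
        rw [mul_comm]
        gcongr
        exact hs.sum_le_tsum _ fun _ _ => by positivity

/-- Quadruples `((i, j), (k, l))` below `N` with `(P+i)² + (P+j)² = (P+k)² + (P+l)²`. -/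
def equalSquareSums (P N : ℕ) : Finset ((ℕ × ℕ) × ℕ × ℕ) :=
  ((Finset.range N ×ˢ Finset.range N) ×ˢ (Finset.range N ×ˢ Finset.range N)).filter fun kk =>
    ((P + kk.1.1 : ℕ) : ℤ) ^ 2 + ((P + kk.1.2 : ℕ) : ℤ) ^ 2
      = ((P + kk.2.1 : ℕ) : ℤ) ^ 2 + ((P + kk.2.2 : ℕ) : ℤ) ^ 2

theorem sq_le_card_equalSquareSums (P N : ℕ) : N ^ 2 ≤ (equalSquareSums P N).card := by
  have h : N ^ 2 = (Finset.range N ×ˢ Finset.range N).card := by simp [sq]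
  rw [h]
  refine Finset.card_le_card_of_injOn (fun ij => (ij, ij)) ?_ fun a _ b _ hab => (Prod.mk.inj hab).1
  intro ij hij
  rw [Finset.mem_coe] at hij
  simp only [equalSquareSums, Finset.coe_filter, Set.mem_ofPred_eq, and_true]
  exact Finset.mk_mem_product hij hij

/-- Parameters `(b, (c, a, d))` of solutions of `n₁² + n₂² = n₃² + n₄²`. -/
def squareSumParameters (M : ℕ) : Finset (Σ _ : ℕ, ℕ × ℕ × ℕ) :=
  (Finset.Icc 1 (M / 2)).sigma fun b => ((Finset.range b).filter b.Coprime) ×ˢ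
    (Finset.Icc 1 (M / (2 * b)) ×ˢ Finset.Icc (2 * M / b + 1) (3 * M / b))

theorem mem_squareSumParameters {M b c a d : ℕ}
    (h : (⟨b, (c, a, d)⟩ : Σ _ : ℕ, ℕ × ℕ × ℕ) ∈ squareSumParameters M) :
    0 < b ∧ 0 < a ∧ c < b ∧ b.Coprime (b + c) ∧ 2 * (a * b) ≤ M ∧ 2 * M ≤ b * d ∧ b * d ≤ 3 * M := by
  simp only [squareSumParameters, Finset.mem_sigma, Finset.mem_Icc, Finset.mem_product,
    Finset.mem_filter, Finset.mem_range] at h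
  obtain ⟨⟨hb, -⟩, ⟨hc, hcop⟩, ⟨ha, ha'⟩, hd, hd'⟩ := h
  rw [Nat.le_div_iff_mul_le (by omega)] at ha' hd'
  have hd2 : 2 * M < d * b := (Nat.div_lt_iff_lt_mul hb).1 (by omega)
  refine ⟨hb, ha, hc, by simpa using hcop, by linarith, by linarith, by linarith⟩

/-- With e = b + c, both (ab + ed)² + (bd - ae)² and (ed - ab)² + (ae + bd)² equal (a² + d²)(b² +
e²). The ranges place all four numbers in [M, 8M), inside [P, P + N). Sums and differences recover
ab, ae and bd; coprimality of b and e gives a = gcd(ab, ae), and the other parameters follow. -/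
theorem card_squareSumParameters_le {P N M : ℕ} (hP : P ≤ M) (hM : 8 * M ≤ P + N) :
    (squareSumParameters M).card ≤ (equalSquareSums P N).card := by
  refine Finset.card_le_card_of_injOn (fun t =>
    ((t.2.2.1 * t.1 + (t.1 + t.2.1) * t.2.2.2 - P, t.1 * t.2.2.2 - t.2.2.1 * (t.1 + t.2.1) - P),
     ((t.1 + t.2.1) * t.2.2.2 - t.2.2.1 * t.1 - P,
      t.2.2.1 * (t.1 + t.2.1) + t.1 * t.2.2.2 - P))) ?_ ?_
  · rintro ⟨b, c, a, d⟩ ht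
    obtain ⟨hb, ha, hc, hcop, hab, hbd, hbd'⟩ := mem_squareSumParameters ht
    have h1 : a * c ≤ a * b := Nat.mul_le_mul_left a hc.le
    have h2 : c * d ≤ b * d := Nat.mul_le_mul_right d hc.le
    have hab0 : 0 < a * b := Nat.mul_pos ha hb
    simp only [equalSquareSums, Finset.coe_filter, Set.mem_ofPred_eq, Finset.mem_product,
      Finset.mem_range, mul_add, add_mul]
    refine ⟨⟨⟨by omega, by omega⟩, by omega, by omega⟩, ?_⟩
    have e1 : P + (a * b + (b * d + c * d) - P) = a * b + (b * d + c * d) := by omega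
    have e2 : ((P + (b * d - (a * b + a * c) - P) : ℕ) : ℤ) = b * d - (a * b + a * c) := by
      push_cast [show P ≤ b * d - (a * b + a * c) by omega, show a * b + a * c ≤ b * d by omega]
      ring
    have e3 : ((P + (b * d + c * d - a * b - P) : ℕ) : ℤ) = b * d + c * d - a * b := by
      push_cast [show P ≤ b * d + c * d - a * b by omega, show a * b ≤ b * d + c * d by omega]
      ring
    have e4 : P + (a * b + a * c + b * d - P) = a * b + a * c + b * d := by omega
    rw [e1, e2, e3, e4]
    push_cast; ring
  · rintro ⟨b, c, a, d⟩ ht ⟨b', c', a', d'⟩ ht' heq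
    obtain ⟨hb, ha, hc, hcop, hab, hbd, hbd'⟩ := mem_squareSumParameters ht
    obtain ⟨kb, ka, kc, kcop, kab, kbd, kbd'⟩ := mem_squareSumParameters ht'
    have h1 : a * c ≤ a * b := Nat.mul_le_mul_left a hc.le
    have h2 : c * d ≤ b * d := Nat.mul_le_mul_right d hc.le
    have k1 : a' * c' ≤ a' * b' := Nat.mul_le_mul_left a' kc.le
    have k2 : c' * d' ≤ b' * d' := Nat.mul_le_mul_right d' kc.le
    simp only [Prod.mk.injEq, mul_add, add_mul] at heq
    obtain ⟨⟨q1, q2⟩, q3, q4⟩ := heq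
    have r1 : a * b = a' * b' := by omega
    have r2 : a * c = a' * c' := by omega
    have r3 : b * d = b' * d' := by omega
    have ea : a = a' := by
      have g1 : Nat.gcd (a * b) (a * (b + c)) = a := by
        rw [Nat.gcd_mul_left, hcop.gcd_eq_one, mul_one]
      have g2 : Nat.gcd (a' * b') (a' * (b' + c')) = a' := by
        rw [Nat.gcd_mul_left, kcop.gcd_eq_one, mul_one]
      rw [← g1, ← g2, mul_add, mul_add, r1, r2]
    subst ea
    have eb := Nat.eq_of_mul_eq_mul_left ha r1
    have ec := Nat.eq_of_mul_eq_mul_left ha r2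
    subst eb ec
    have ed := Nat.eq_of_mul_eq_mul_left hb r3
    subst ed
    rfl

/-- For fixed b there are φ(b) choices of c and, up to constants, M/b choices for each of a and d.
-/
theorem le_card_squareSumParameters (M : ℕ) :
    (M : ℝ) ^ 2 / 8 * ∑ b ∈ Finset.Icc 1 (M / 2), (b.totient : ℝ) / b ^ 2
      ≤ (squareSumParameters M).card := by
  rw [squareSumParameters, Finset.card_sigma, Finset.mul_sum]
  push_cast
  refine Finset.sum_le_sum fun b hb => ?_
  obtain ⟨hb1, hb2⟩ := Finset.mem_Icc.1 hb
  have hb0 : (0 : ℝ) < b := by exact_mod_cast hb1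
  have hbM : 2 * b ≤ M := by omega
  have hhalf : ∀ k : ℕ, 0 < k → k ≤ M → (M : ℝ) / (2 * k) ≤ (M / k : ℕ) := by
    intro k hk hkM
    have h1 := Nat.lt_div_mul_add hk (a := M)
    have h2 : 1 ≤ M / k := (Nat.one_le_div_iff hk).2 hkM
    have h3 : M ≤ M / k * (2 * k) := by nlinarith
    rw [div_le_iff₀ (by positivity)]
    exact_mod_cast h3
  have h1 : (M : ℝ) / (4 * b) ≤ (M / (2 * b) : ℕ) := by
    have := hhalf (2 * b) (by omega) hbM
    push_cast at this
    rwa [← mul_assoc, show (2 : ℝ) * 2 = 4 by norm_num] at this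
  have h2 : (M : ℝ) / (2 * b) ≤ (3 * M / b - 2 * M / b : ℕ) := by
    refine (hhalf b (by omega) (by omega)).trans ?_
    have : 2 * M / b + M / b ≤ (2 * M + M) / b := Nat.div_add_div_le_add_div
    rw [show 2 * M + M = 3 * M by ring] at this
    exact_mod_cast (by omega)
  rw [Finset.card_product, Finset.card_product, Nat.card_Icc, Nat.card_Icc, Nat.add_sub_cancel,
    Nat.add_sub_add_right, ← Nat.totient_eq_card_coprime]
  push_cast
  calc (M : ℝ) ^ 2 / 8 * (b.totient / b ^ 2) = b.totient * (M / (4 * b) * (M / (2 * b))) := by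
        field_simp; ring
    _ ≤ _ := by gcongr

theorem exists_mul_le_card_equalSquareSums :
    ∃ c : ℝ, 0 < c ∧ ∀ P N : ℕ, 0 < N → 7 * P ≤ N →
      c * ((N : ℝ) ^ 2 * (1 + Real.log N)) ≤ (equalSquareSums P N).card := by
  obtain ⟨c, hc, hsum⟩ := exists_mul_log_le_sum_totient_div_sq
  have hlog32 : 0 ≤ Real.log 32 := Real.log_nonneg (by norm_num)
  -- 2048 = 8 · 16² comes from the factor M²/8 and N ≤ 16M. The diagonal solutions, at least N² in
  -- number, pay for the remaining 1 + log 32.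
  set κ := 2048 / c + (1 + Real.log 32) with hκ
  have hκ0 : 0 < κ := by positivity
  refine ⟨κ⁻¹, by positivity, fun P N hN hPN => ?_⟩
  rw [inv_mul_le_iff₀ hκ0]
  set E : ℝ := ((equalSquareSums P N).card : ℝ) with hE
  have hN' : (0 : ℝ) < N := by exact_mod_cast hN
  have hdiag : (N : ℝ) ^ 2 ≤ E := by
    rw [hE]; exact_mod_cast sq_le_card_equalSquareSums P N
  have hmain : (N : ℝ) ^ 2 * (Real.log N - Real.log 32) ≤ 2048 / c * E := by
    rcases lt_or_ge N 32 with h | h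
    · have h1 : Real.log N ≤ Real.log 32 := Real.log_le_log hN' (by exact_mod_cast h.le)
      have h2 : 0 ≤ 2048 / c * E := by positivity
      nlinarith [sq_nonneg (N : ℝ)]
    set M := (P + N) / 8 with hM
    have hM1 : (N : ℝ) ≤ 16 * M := by exact_mod_cast (show N ≤ 16 * M by omega)
    have hM2 : (N : ℝ) ≤ 32 * ((M / 2 : ℕ) + 1 : ℝ) := by
      exact_mod_cast (show N ≤ 32 * (M / 2 + 1) by omega)
    have h1 := hsum (M / 2)
    have h2 := le_card_squareSumParameters M
    have h3 : ((squareSumParameters M).card : ℝ) ≤ E := by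
      rw [hE]; exact_mod_cast card_squareSumParameters_le (by omega) (by omega)
    have h4 : Real.log N - Real.log 32 ≤ Real.log ((M / 2 : ℕ) + 1) := by
      rw [← Real.log_div hN'.ne' (by norm_num)]
      refine Real.log_le_log (by positivity) ?_
      rw [div_le_iff₀ (by norm_num)]; linarith
    have h5 : 0 ≤ Real.log N - Real.log 32 :=
      sub_nonneg.2 (Real.log_le_log (by norm_num) (by exact_mod_cast h))
    calc (N : ℝ) ^ 2 * (Real.log N - Real.log 32)
        ≤ (16 * M) ^ 2 * Real.log ((M / 2 : ℕ) + 1) := by gcongr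
      _ = 2048 / c * (M ^ 2 / 8 * (c * Real.log ((M / 2 : ℕ) + 1))) := by field_simp; ring
      _ ≤ 2048 / c * (M ^ 2 / 8 * ∑ b ∈ Finset.Icc 1 (M / 2), (b.totient : ℝ) / b ^ 2) := by
          gcongr
      _ ≤ 2048 / c * E := by gcongr; exact h2.trans h3
  calc (N : ℝ) ^ 2 * (1 + Real.log N)
      = N ^ 2 * (Real.log N - Real.log 32) + N ^ 2 * (1 + Real.log 32) := by ring
    _ ≤ 2048 / c * E + E * (1 + Real.log 32) := by gcongr
    _ = κ * E := by rw [hκ]; ring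

/-! ### Two-sided bounds for sums and blocks -/

theorem four_mul_card_le_integral_norm_weightedSum {w : ℕ → ℝ} {v : ℝ} (P N : ℕ) (hv : 0 ≤ v)
    (hw : ∀ i < N, v ≤ w i) :
    v ^ 4 * (equalSquareSums P N).card ≤ ∫ x, ‖weightedSum w P N x‖ ^ (4 : ℝ) := by
  have hsq : ∀ x, ‖weightedSum w P N x‖ ^ (4 : ℝ)
      = ‖∑ ij ∈ Finset.range N ×ˢ Finset.range N, ((w ij.1 * w ij.2 : ℝ) : ℂ) *
        fourier (((P + ij.1 : ℕ) : ℤ) ^ 2 + ((P + ij.2 : ℕ) : ℤ) ^ 2) x‖ ^ 2 := by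
    intro x
    have h : weightedSum w P N x ^ 2
        = ∑ ij ∈ Finset.range N ×ˢ Finset.range N, ((w ij.1 * w ij.2 : ℝ) : ℂ) *
          fourier (((P + ij.1 : ℕ) : ℤ) ^ 2 + ((P + ij.2 : ℕ) : ℤ) ^ 2) x := by
      rw [sq, weightedSum, Finset.sum_mul_sum, ← Finset.sum_product']
      refine Finset.sum_congr rfl fun ij _ => ?_
      rw [mul_mul_mul_comm, ← fourier_add, Complex.ofReal_mul]
    rw [← h, norm_pow, ← pow_mul, ← Real.rpow_natCast]
    norm_num
  simp only [hsq]
  have h := sq_mul_card_le_integral_norm_sq_sum_fourier (Finset.range N ×ˢ Finset.range N)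
    (c := fun ij => w ij.1 * w ij.2)
    (fun ij => ((P + ij.1 : ℕ) : ℤ) ^ 2 + ((P + ij.2 : ℕ) : ℤ) ^ 2) (v := v ^ 2)
    (by positivity) (fun ij hij => by
      rw [Finset.mem_product, Finset.mem_range, Finset.mem_range] at hij
      rw [sq]
      exact mul_le_mul (hw _ hij.1) (hw _ hij.2) hv (hv.trans (hw _ hij.1)))
  rw [← pow_mul] at h
  exact h

theorem gaussRate_four_rpow (N : ℕ) :
    gaussRate 4 N ^ (4 : ℝ) = (N : ℝ) ^ 2 * (1 + Real.log N) := by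
  have := Real.log_natCast_nonneg N
  rw [gaussRate, if_neg (lt_irrefl _), if_pos rfl, Real.mul_rpow (by positivity) (by positivity),
    ← Real.rpow_mul (by positivity), ← Real.rpow_mul (by positivity),
    show (1 / 4 * 4 : ℝ) = 1 by norm_num, Real.rpow_one, show (1 / 2 * 4 : ℝ) = 2 by norm_num,
    Real.rpow_two]

theorem exists_mul_gaussRate_four_le_torusNorm :
    ∃ c : ℝ, 0 < c ∧ ∀ (w : ℕ → ℝ) (v : ℝ) (P N : ℕ), 0 < N → (7 * P ≤ N ∨ N ≤ 7) → 0 ≤ v →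
      (∀ i < N, v ≤ w i) → c * (v * gaussRate 4 N) ≤ torusNorm 4 (weightedSum w P N) := by
  obtain ⟨c, hc, hcount⟩ := exists_mul_le_card_equalSquareSums
  have hlog7 : 0 ≤ Real.log 7 := Real.log_nonneg (by norm_num)
  -- For N ≤ 7 the diagonal solutions alone suffice; this case is needed for `K_N`, where P = 1 and
  -- 7P ≤ N may fail.
  set c' := min c (1 + Real.log 7)⁻¹ with hc'
  have hc0 : 0 < c' := lt_min hc (by positivity)
  refine ⟨c' ^ (1 / 4 : ℝ), by positivity, fun w v P N hN hPN hv hw => ?_⟩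
  have hG := gaussRate_nonneg 4 N
  have hlogN := Real.log_natCast_nonneg N
  refine le_torusNorm_of_le_integral (by norm_num) (by positivity) (continuous_weightedSum _ _ _)
    (le_trans ?_ (four_mul_card_le_integral_norm_weightedSum P N hv hw))
  rw [Real.mul_rpow (by positivity) (by positivity), Real.mul_rpow hv hG, gaussRate_four_rpow,
    ← Real.rpow_mul hc0.le, one_div_mul_cancel (by norm_num), Real.rpow_one, mul_left_comm]
  have hv4 : v ^ (4 : ℝ) = v ^ 4 := by exact_mod_cast Real.rpow_natCast v 4
  rw [hv4]
  gcongr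
  rcases hPN with h | h
  · refine le_trans ?_ (hcount P N hN h)
    gcongr
    exact min_le_left _ _
  · calc c' * ((N : ℝ) ^ 2 * (1 + Real.log N))
        ≤ (1 + Real.log 7)⁻¹ * ((N : ℝ) ^ 2 * (1 + Real.log 7)) := by
          gcongr
          · exact min_le_right _ _
          · exact_mod_cast h
      _ = (N : ℝ) ^ 2 := by field_simp
      _ ≤ _ := by exact_mod_cast sq_le_card_equalSquareSums P N

theorem exists_mul_gaussRate_le_torusNorm_weightedSum {p : ℝ} (hp : 0 < p) {R : ℝ} (hR : 0 < R) :
    ∃ c : ℝ, 0 < c ∧ ∀ (w : ℕ → ℝ) (v : ℝ) (P N : ℕ), 0 < N → P ≤ N → (7 * P ≤ N ∨ N ≤ 7) →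
      0 < v → (Monotone w ∨ Antitone w) → (∀ i < N, v ≤ w i ∧ w i ≤ R * v) →
      c * (v * gaussRate p N) ≤ torusNorm p (weightedSum w P N) := by
  rcases lt_trichotomy p 4 with h4 | h4 | h4
  · obtain ⟨C, hC, hup⟩ := exists_torusNorm_weightedSum_le 3
    obtain ⟨c, hc, h⟩ := exists_mul_le_torusNorm_of_integral_sq_of_torusNorm_three hp
      (D := C * R) (by positivity)
    refine ⟨c, hc, fun w v P N hN _ _ hv hmono hw => ?_⟩
    have hN' : (0 : ℝ) < N := by exact_mod_cast hN
    rw [gaussRate, if_pos h4]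
    refine h _ _ (continuous_weightedSum _ _ _) (by positivity) ?_ ?_
    · refine le_of_eq_of_le ?_
        (sq_mul_le_integral_norm_sq_weightedSum P N hv.le fun i hi => (hw i hi).1)
      rw [mul_pow, ← Real.sqrt_eq_rpow, Real.sq_sqrt hN'.le]
    · refine (hup w (R * v) P N hN hmono
        fun i hi => ⟨hv.le.trans (hw i hi).1, (hw i hi).2⟩).trans (le_of_eq ?_)
      rw [gaussRate, if_pos (by norm_num)]
      ring
  · subst h4
    obtain ⟨c, hc, h⟩ := exists_mul_gaussRate_four_le_torusNorm
    exact ⟨c, hc, fun w v P N hN _ hPN hv _ hw => h w v P N hN hPN hv.le fun i hi => (hw i hi).1⟩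
  · obtain ⟨c, hc, h⟩ := exists_mul_rpow_le_torusNorm_weightedSum hp
    refine ⟨c, hc, fun w v P N hN hPN _ hv _ hw => ?_⟩
    rw [gaussRate, if_neg h4.not_gt, if_neg h4.ne']
    exact h w v P N hN hPN hv.le fun i hi => (hw i hi).1

/-! ### The sums `K_N` and the blocks as weighted sums -/

theorem squareSum_eq_weightedSum (N : ℕ) : squareSum N = weightedSum (fun _ => 1) 1 N := by
  funext x
  have : Finset.Icc 1 N = Finset.Ico 1 (N + 1) := by ext; simp
  rw [squareSum, weightedSum, this, Finset.sum_Ico_eq_sum_range, Nat.add_sub_cancel]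
  simp only [Complex.ofReal_one, one_mul]

theorem exists_gaussRate_le_torusNorm_squareSum_le {p : ℝ} (hp : 0 < p) :
    ∃ c C : ℝ, 0 < c ∧ 0 < C ∧ ∀ N : ℕ, 0 < N →
      c * gaussRate p N ≤ torusNorm p (squareSum N) ∧
      torusNorm p (squareSum N) ≤ C * gaussRate p N := by
  obtain ⟨C, hC, hup⟩ := exists_torusNorm_weightedSum_le p
  obtain ⟨c, hc, hlow⟩ := exists_mul_gaussRate_le_torusNorm_weightedSum hp one_pos
  refine ⟨c, C, hc, hC, fun N hN => ?_⟩
  rw [squareSum_eq_weightedSum]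
  constructor
  · simpa using hlow (fun _ => 1) 1 1 N hN hN (by omega) one_pos (Or.inl monotone_const)
      fun i _ => by norm_num
  · simpa using hup (fun _ => 1) 1 1 N hN (Or.inl monotone_const) fun i _ => by norm_num

theorem squareBlock_eq_weightedSum (s : ℝ) (A k : ℕ) :
    squareBlock s A k = weightedSum (fun i => ((A ^ k + i : ℕ) : ℝ) ^ (-(2 * s))) (A ^ k)
      (A ^ (k + 1) - A ^ k) := by
  funext x
  rw [squareBlock, weightedSum, Finset.sum_Ico_eq_sum_range]
  refine Finset.sum_congr rfl fun i _ => ?_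
  rw [Real.rpow_neg (by positivity), Complex.ofReal_inv, div_eq_inv_mul]

theorem monotone_or_antitone_natCast_add_rpow {P : ℕ} (hP : 0 < P) (a : ℝ) :
    (Monotone fun i : ℕ => ((P + i : ℕ) : ℝ) ^ a) ∨ Antitone fun i : ℕ => ((P + i : ℕ) : ℝ) ^ a := by
  rcases le_total 0 a with h | h
  · left
    intro i j hij
    have : ((P + i : ℕ) : ℝ) ≤ (P + j : ℕ) := by exact_mod_cast (by omega)
    exact Real.rpow_le_rpow (by positivity) this h
  · right
    intro i j hij
    have : ((P + i : ℕ) : ℝ) ≤ (P + j : ℕ) := by exact_mod_cast (by omega)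
    exact Real.rpow_le_rpow_of_nonpos (by positivity) this h

/-- The ratio y/Q lies in [1, A]. The absolute value of the exponent treats growing and decaying
weights together. -/
theorem rpow_neg_abs_mul_le_rpow {A Q y : ℝ} (hQ : 0 < Q) (hy : Q ≤ y) (hA : y ≤ A * Q) (a : ℝ) :
    A ^ (-|a|) * Q ^ a ≤ y ^ a ∧ y ^ a ≤ A ^ |a| * Q ^ a := by
  have hu1 : 1 ≤ y / Q := (one_le_div hQ).2 hy
  have huA : y / Q ≤ A := (div_le_iff₀ hQ).2 hA
  have hu0 : 0 < y / Q := by linarith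
  have he : y ^ a = (y / Q) ^ a * Q ^ a := by
    rw [← Real.mul_rpow hu0.le hQ.le, div_mul_cancel₀ _ hQ.ne']
  rw [he]
  constructor
  · gcongr
    calc A ^ (-|a|) ≤ (y / Q) ^ (-|a|) := Real.rpow_le_rpow_of_nonpos hu0 huA (by simp)
      _ ≤ _ := Real.rpow_le_rpow_of_exponent_le hu1 (neg_abs_le a)
  · gcongr
    calc (y / Q) ^ a ≤ (y / Q) ^ |a| := Real.rpow_le_rpow_of_exponent_le hu1 (le_abs_self a)
      _ ≤ _ := by gcongr

theorem gaussRate_mul_le {p : ℝ} {A n : ℕ} (hA : 0 < A) (hn : 0 < n) :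
    gaussRate p (A * n) ≤ A * (1 + Real.log A) * gaussRate p n := by
  have hlA := Real.log_natCast_nonneg A
  have hln := Real.log_natCast_nonneg n
  have hA1 : (1 : ℝ) ≤ A := by exact_mod_cast hA
  have hn0 : (0 : ℝ) < n := by exact_mod_cast hn
  have hpow : ∀ a : ℝ, a ≤ 1 → ((A * n : ℕ) : ℝ) ^ a ≤ A * (n : ℝ) ^ a := by
    intro a ha
    push_cast
    rw [Real.mul_rpow (by positivity) hn0.le]
    gcongr
    simpa using Real.rpow_le_rpow_of_exponent_le hA1 ha
  have h1A : (A : ℝ) ≤ A * (1 + Real.log A) := le_mul_of_one_le_right (by positivity) (by linarith)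
  unfold gaussRate
  split_ifs with h4 h5
  · exact (hpow _ (by norm_num)).trans (by gcongr)
  · have hl : (1 + Real.log ((A * n : ℕ) : ℝ)) ^ (1 / 4 : ℝ)
        ≤ (1 + Real.log A) * (1 + Real.log n) ^ (1 / 4 : ℝ) := by
      push_cast
      rw [Real.log_mul (by positivity) hn0.ne']
      calc (1 + (Real.log A + Real.log n)) ^ (1 / 4 : ℝ)
          ≤ ((1 + Real.log A) * (1 + Real.log n)) ^ (1 / 4 : ℝ) := by
            gcongr; nlinarith [mul_nonneg hlA hln]
        _ = (1 + Real.log A) ^ (1 / 4 : ℝ) * (1 + Real.log n) ^ (1 / 4 : ℝ) :=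
            Real.mul_rpow (by positivity) (by positivity)
        _ ≤ _ := by
            gcongr
            simpa using Real.rpow_le_rpow_of_exponent_le (x := 1 + Real.log A) (by linarith)
              (show (1 / 4 : ℝ) ≤ 1 by norm_num)
    calc _ ≤ (A * (n : ℝ) ^ (1 / 2 : ℝ)) * ((1 + Real.log A) * (1 + Real.log n) ^ (1 / 4 : ℝ)) := by
          gcongr
          exact hpow _ (by norm_num)
      _ = _ := by ring
  · have : (0 : ℝ) < 2 / p := by
      have : 4 ≤ p := not_lt.1 h4
      positivity
    exact (hpow _ (by linarith)).trans (by gcongr)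

theorem exists_gaussRate_le_torusNorm_squareBlock_le {p : ℝ} (hp : 0 < p) {A : ℕ} (hA : 8 ≤ A)
    (s : ℝ) : ∃ c C : ℝ, 0 < c ∧ 0 < C ∧ ∀ k : ℕ,
      c * (gaussRate p (A ^ k) / (A : ℝ) ^ (2 * (k : ℝ) * s)) ≤ torusNorm p (squareBlock s A k) ∧
      torusNorm p (squareBlock s A k)
        ≤ C * (gaussRate p (A ^ k) / (A : ℝ) ^ (2 * (k : ℝ) * s)) := by
  have hA0 : (0 : ℝ) < A := by exact_mod_cast (by omega : 0 < A)
  have hlA := Real.log_natCast_nonneg A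
  set a := -(2 * s) with ha
  obtain ⟨C, hC, hup⟩ := exists_torusNorm_weightedSum_le p
  obtain ⟨c, hc, hlow⟩ := exists_mul_gaussRate_le_torusNorm_weightedSum hp
    (R := (A : ℝ) ^ (2 * |a|)) (by positivity)
  refine ⟨c * (A : ℝ) ^ (-|a|), C * ((A : ℝ) ^ |a| * (A * (1 + Real.log A))), by positivity,
    by positivity, fun k => ?_⟩
  set Q := A ^ k with hQ
  have hQ0 : 0 < Q := Nat.pow_pos (by omega)
  have hQ' : (0 : ℝ) < Q := by exact_mod_cast hQ0
  have hAQ : A ^ (k + 1) = A * Q := by rw [hQ, pow_succ, mul_comm]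
  have h8Q : 8 * Q ≤ A * Q := Nat.mul_le_mul_right Q hA
  have hQa : (Q : ℝ) ^ a = ((A : ℝ) ^ (2 * (k : ℝ) * s))⁻¹ := by
    rw [hQ, Nat.cast_pow, ← Real.rpow_natCast, ← Real.rpow_mul hA0.le, ← Real.rpow_neg hA0.le]
    congr 1; rw [ha]; ring
  rw [squareBlock_eq_weightedSum, div_eq_mul_inv, ← hQa, hAQ]
  have hweights : ∀ i < A * Q - Q, (A : ℝ) ^ (-|a|) * (Q : ℝ) ^ a ≤ ((Q + i : ℕ) : ℝ) ^ a ∧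
      ((Q + i : ℕ) : ℝ) ^ a ≤ (A : ℝ) ^ |a| * (Q : ℝ) ^ a := fun i hi =>
    rpow_neg_abs_mul_le_rpow hQ' (by exact_mod_cast Nat.le_add_right _ _)
      (by exact_mod_cast (by omega : Q + i ≤ A * Q)) a
  have hmono := monotone_or_antitone_natCast_add_rpow hQ0 a
  constructor
  -- As A ≥ 8, the block has length AQ - Q ≥ 7Q, which meets the length conditions of the lower
  -- bound for every p.
  · have h := hlow _ ((A : ℝ) ^ (-|a|) * (Q : ℝ) ^ a) Q (A * Q - Q) (by omega) (by omega)
      (Or.inl (by omega)) (by positivity) hmono fun i hi => by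
        refine ⟨(hweights i hi).1, (hweights i hi).2.trans (le_of_eq ?_)⟩
        rw [← mul_assoc, ← Real.rpow_add hA0]; congr 2; ring
    refine le_trans ?_ h
    calc _ = c * ((A : ℝ) ^ (-|a|) * (Q : ℝ) ^ a * gaussRate p Q) := by ring
      _ ≤ _ := by
        gcongr
        exact gaussRate_mono (by omega)
  · have h := hup _ ((A : ℝ) ^ |a| * (Q : ℝ) ^ a) Q (A * Q - Q) (by omega) hmono
      fun i hi => ⟨by positivity, (hweights i hi).2⟩
    refine h.trans ?_
    calc _ ≤ C * ((A : ℝ) ^ |a| * (Q : ℝ) ^ a * (A * (1 + Real.log A) * gaussRate p Q)) := by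
          gcongr
          exact (gaussRate_mono (Nat.sub_le _ _)).trans (gaussRate_mul_le (by omega) hQ0)
      _ = _ := by ring

/-! ### From `gaussRate` to `blockRate` -/

theorem natCast_pow_rpow_div {A : ℕ} (hA : 0 < A) (k : ℕ) (s a : ℝ) :
    ((A ^ k : ℕ) : ℝ) ^ a / (A : ℝ) ^ (2 * (k : ℝ) * s) = (A : ℝ) ^ ((k : ℝ) * (a - 2 * s)) := by
  have hA' : (0 : ℝ) < A := by exact_mod_cast hA
  rw [Nat.cast_pow, ← Real.rpow_natCast, ← Real.rpow_mul hA'.le, ← Real.rpow_sub hA']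
  congr 1; ring

theorem blockRate_eq_gaussRate_div {p : ℝ} (hp : p ≠ 4) {A : ℕ} (hA : 0 < A) (s : ℝ) (k : ℕ) :
    blockRate p s A k = gaussRate p (A ^ k) / (A : ℝ) ^ (2 * (k : ℝ) * s) := by
  unfold blockRate gaussRate
  split_ifs with h4
  · rw [natCast_pow_rpow_div hA]
  · rw [natCast_pow_rpow_div hA]

/-- log(A^k) = k log A, and k log A ≤ 1 + k log A ≤ (1 + log A) k. The last inequality uses k ≥ 1;
at k = 0 the rate `blockRate` vanishes while `gaussRate` does not. -/
theorem blockRate_four_le {A : ℕ} (hA : 2 ≤ A) (s : ℝ) {k : ℕ} (hk : 1 ≤ k) :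
    Real.log A ^ (1 / 4 : ℝ) * blockRate 4 s A k
        ≤ gaussRate 4 (A ^ k) / (A : ℝ) ^ (2 * (k : ℝ) * s) ∧
      gaussRate 4 (A ^ k) / (A : ℝ) ^ (2 * (k : ℝ) * s)
        ≤ (1 + Real.log A) ^ (1 / 4 : ℝ) * blockRate 4 s A k := by
  have hk' : (1 : ℝ) ≤ k := by exact_mod_cast hk
  have hlog := Real.log_natCast_nonneg A
  have hb : blockRate 4 s A k
      = (A : ℝ) ^ ((k : ℝ) * (1 / 2 - 2 * s)) * (k : ℝ) ^ (1 / 4 : ℝ) := by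
    rw [blockRate, if_neg (lt_irrefl _), if_pos rfl]
  have hg : gaussRate 4 (A ^ k) / (A : ℝ) ^ (2 * (k : ℝ) * s)
      = (A : ℝ) ^ ((k : ℝ) * (1 / 2 - 2 * s)) * (1 + k * Real.log A) ^ (1 / 4 : ℝ) := by
    rw [gaussRate, if_neg (lt_irrefl _), if_pos rfl, mul_div_right_comm,
      natCast_pow_rpow_div (by omega), Nat.cast_pow, Real.log_pow]
  rw [hb, hg]
  constructor
  · rw [mul_left_comm, ← Real.mul_rpow hlog (by positivity)]
    gcongr
    linarith
  · rw [mul_left_comm, ← Real.mul_rpow (by positivity) (by positivity)]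
    gcongr
    linarith

theorem mainTheorem9 (p : ℝ) (hp : 0 < p) :
    -- the block is comparable to `‖K_{A^k}‖_p / A^{2ks}`, for all `A` large in terms of `p`
    (∃ A₀ : ℕ, 2 ≤ A₀ ∧ ∀ A : ℕ, A₀ ≤ A → ∀ s : ℝ, ∃ c C : ℝ, 0 < c ∧ 0 < C ∧ ∀ k : ℕ,
      c * (torusNorm p (squareSum (A ^ k)) / (A : ℝ) ^ (2 * (k : ℝ) * s))
          ≤ torusNorm p (squareBlock s A k) ∧
      torusNorm p (squareBlock s A k)
          ≤ C * (torusNorm p (squareSum (A ^ k)) / (A : ℝ) ^ (2 * (k : ℝ) * s))) ∧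
    -- for `p ≠ 4`, `‖K_{A^k}‖_p / A^{2ks}` is comparable to the rate, constants depend on `p` only
    (p ≠ 4 → ∃ c C : ℝ, 0 < c ∧ 0 < C ∧ ∀ A : ℕ, 2 ≤ A → ∀ (s : ℝ) (k : ℕ),
      c * blockRate p s A k
          ≤ torusNorm p (squareSum (A ^ k)) / (A : ℝ) ^ (2 * (k : ℝ) * s) ∧
      torusNorm p (squareSum (A ^ k)) / (A : ℝ) ^ (2 * (k : ℝ) * s)
          ≤ C * blockRate p s A k) ∧
    -- for `p = 4`, the same for `k ≥ 1`, with constants that depend on `A`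
    (p = 4 → ∀ A : ℕ, 2 ≤ A → ∃ c C : ℝ, 0 < c ∧ 0 < C ∧ ∀ (s : ℝ) (k : ℕ), 1 ≤ k →
      c * blockRate p s A k
          ≤ torusNorm p (squareSum (A ^ k)) / (A : ℝ) ^ (2 * (k : ℝ) * s) ∧
      torusNorm p (squareSum (A ^ k)) / (A : ℝ) ^ (2 * (k : ℝ) * s)
          ≤ C * blockRate p s A k) := by

  obtain ⟨c, C, hc, hC, hK⟩ := exists_gaussRate_le_torusNorm_squareSum_le hp
  have hKd : ∀ A : ℕ, 2 ≤ A → ∀ (s : ℝ) (k : ℕ),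
      c * (gaussRate p (A ^ k) / (A : ℝ) ^ (2 * (k : ℝ) * s))
        ≤ torusNorm p (squareSum (A ^ k)) / (A : ℝ) ^ (2 * (k : ℝ) * s) ∧
      torusNorm p (squareSum (A ^ k)) / (A : ℝ) ^ (2 * (k : ℝ) * s)
        ≤ C * (gaussRate p (A ^ k) / (A : ℝ) ^ (2 * (k : ℝ) * s)) := by
    intro A hA s k
    have hA0 : (0 : ℝ) < A := by exact_mod_cast (by omega : 0 < A)
    obtain ⟨h1, h2⟩ := hK (A ^ k) (Nat.pow_pos (by omega))
    rw [← mul_div_assoc, ← mul_div_assoc]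
    exact ⟨by gcongr, by gcongr⟩
  -- The threshold 8 works for every p.
  refine ⟨⟨8, by norm_num, fun A hA s => ?_⟩, fun hp4 => ⟨c, C, hc, hC, fun A hA s k => ?_⟩,
    fun hp4 A hA => ?_⟩
  · obtain ⟨c', C', hc', hC', hB⟩ := exists_gaussRate_le_torusNorm_squareBlock_le hp hA s
    refine ⟨c' / C, C' / c, by positivity, by positivity, fun k => ?_⟩
    obtain ⟨h1, h2⟩ := hKd A (by omega) s k
    obtain ⟨h3, h4⟩ := hB k
    constructor
    · refine le_trans ?_ h3
      rw [div_mul_eq_mul_div, div_le_iff₀ hC]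
      exact (mul_le_mul_of_nonneg_left h2 hc'.le).trans_eq (by ring)
    · refine h4.trans ?_
      rw [div_mul_eq_mul_div, le_div_iff₀ hc]
      exact (mul_le_mul_of_nonneg_left h1 hC'.le).trans_eq' (by ring)
  · rw [blockRate_eq_gaussRate_div hp4 (by omega)]
    exact hKd A hA s k
  · subst hp4
    have hlog : 0 < Real.log A := Real.log_pos (by exact_mod_cast (by omega : 1 < A))
    refine ⟨c * Real.log A ^ (1 / 4 : ℝ), C * (1 + Real.log A) ^ (1 / 4 : ℝ), by positivity,
      by positivity, fun s k hk => ?_⟩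
    obtain ⟨h1, h2⟩ := hKd A hA s k
    obtain ⟨h3, h4⟩ := blockRate_four_le hA s hk
    rw [mul_assoc c, mul_assoc C]
    exact ⟨(mul_le_mul_of_nonneg_left h3 hc.le).trans h1,
      h2.trans (mul_le_mul_of_nonneg_left h4 hC.le)⟩
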